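/- Let $N$ be a connected, oriented 3-manifold with an ideal triangulation: $N$ is obtained from finitely many oriented Euclidean 3-simplices with their vertices removed by gluing their faces in pairs by orientation-reversing isometries (no face is paired with itself, and no edge is identified with its own reverse). Label the edges of each oriented tetrahedron $\sigma_i$ by $z_i,z_i',z_i''\in\mathbb C\setminus\{0\}$, with opposite edges carrying the same label and with the cyclic order of the labels at each vertex fixed by the orientation. Suppose that $Z=(z_i,z_i',z_i'')_i$ satisfies $$z_i(1-z_i'')=1,\qquad z_i'(1-z_i)=1,\qquad z_i''(1-z_i')=1$$ for every tetrahedron, and the hyperbolic gluing equations: for every edge $e$ of $N$, the product of the labels of all edges of tetrahedra that are identified to $e$ equals $1$. Let $p:\widetilde N\to N$ be the universal covering, on which $\pi_1(N)$ acts by deck transformations. A map from an ideal 3-simplex to $\mathbb H^3$ is called straight, with ideal vertices $v_0,\dots,v_3\in\partial\mathbb H^3$, if, up to precomposition with a homeomorphism of the closed simplex that preserves each face, it is the projectively straight map in the hyperboloid model determined by light-like vectors that represent the $v_k$. A pseudo-developing map for $Z$ is a continuous map $\Phi:\widetilde N\to\mathbb H^3$ that maps every ideal tetrahedron of $\widetilde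 N$ (every lift of some $\sigma_i$) by a straight map to an ideal hyperbolic tetrahedron, possibly flat or negatively oriented, whose shape parameters are $(z_i,z_i',z_i'')$ at the edges so labelled. Then: 1. There are a pseudo-developing map $\Phi$ for $Z$ and a representation $\rho:\pi_1(N)\to PSL_2(\mathbb C)$ with $\Phi(\gamma\cdot x)=\rho(\gamma)\Phi(x)$ for all $\gamma\in\pi_1(N)$, $x\in\widetilde N$. 2. The pair $(\Phi,\rho)$ can be chosen such that $\Phi$ maps a given ideal tetrahedron of $\widetilde N$ to any given ideal hyperbolic tetrahedron (with ordered ideal vertices) of the shape prescribed by $Z$. 3. If $(\Phi,\rho)$ and $(\Phi',\rho')$ are two such equivariant pairs, then there is a unique $g\in PSL_2(\mathbb C)$ such that, for each ideal tetrahedron of $\widetilde N$, the ideal vertices of its image under $\Phi'$ are the images under $g$ of those under $\Phi$, and $\rho'(\gamma)=g\,\rho(\gamma)\,g^{-1}$ for all $\gamma$. -/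

import Mathlib

namespace IdealHyp

open scoped LinearAlgebra.Projectivization ComplexOrder

/-! ## Hyperbolic space, its ideal boundary, and the action of `PSL₂(ℂ)` -/

/-- The group `PSL₂(ℂ)`. -/
abbrev PSL2C : Type := Matrix.ProjectiveSpecialLinearGroup (Fin 2) ℂ

/-- Hyperbolic 3-space, in the hyperboloid model: the space of Hermitian `2 × 2` matrices with the
Lorentzian quadratic form `-det` is Minkowski space, and hyperbolic space is the sheet of
the hyperboloid `det = 1` that consists of positive definite matrices (with the subspace
topology). -/
def H3 : Type := {A : Matrix (Fin 2) (Fin 2) ℂ // A.PosDef ∧ A.det = 1}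

instance : TopologicalSpace H3 :=
  inferInstanceAs (TopologicalSpace {A : Matrix (Fin 2) (Fin 2) ℂ // A.PosDef ∧ A.det = 1})

/-- The ideal boundary `∂ℍ³ = ℂP¹`. The line spanned by `u ∈ ℂ² ∖ {0}` corresponds to the ray of the
light cone spanned by the Hermitian matrix `u u*`. -/
abbrev Ideal3 : Type := ℙ ℂ (Fin 2 → ℂ)

/-- `SL₂(ℂ)` acts on hyperbolic space by `A ↦ g A g*`. -/
instance : MulAction (Matrix.SpecialLinearGroup (Fin 2) ℂ) H3 where
  smul g A := ⟨g.1 * A.1 * g.1.conjTranspose, by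
    have hu : IsUnit g.1 := by
      rw [Matrix.isUnit_iff_isUnit_det, g.2]
      exact isUnit_one
    refine ⟨A.2.1.mul_mul_conjTranspose_same (Matrix.vecMul_injective_of_isUnit hu), ?_⟩
    rw [Matrix.det_mul, Matrix.det_mul, Matrix.det_conjTranspose, g.2, A.2.2]
    simp⟩
  one_smul A := Subtype.ext (by
    change (1 : Matrix (Fin 2) (Fin 2) ℂ) * A.1 * (1 : Matrix (Fin 2) (Fin 2) ℂ).conjTranspose = A.1
    simp)
  mul_smul g h A := Subtype.ext (by
    change (g.1 * h.1) * A.1 * (g.1 * h.1).conjTranspose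
      = g.1 * (h.1 * A.1 * h.1.conjTranspose) * g.1.conjTranspose
    rw [Matrix.conjTranspose_mul]
    simp only [Matrix.mul_assoc])

theorem center_le_ker_toPermHom :
    Subgroup.center (Matrix.SpecialLinearGroup (Fin 2) ℂ) ≤
      (MulAction.toPermHom (Matrix.SpecialLinearGroup (Fin 2) ℂ) H3).ker := by
  intro g hg
  obtain ⟨r, hr, hg⟩ := Matrix.SpecialLinearGroup.mem_center_iff.mp hg
  rw [MonoidHom.mem_ker]
  ext1 A
  refine Subtype.ext ?_
  change g.1 * A.1 * g.1.conjTranspose = A.1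
  have h1 : r * star r = 1 := by
    have h2 : ‖r‖ ^ 2 = 1 := by
      rw [← norm_pow]
      simpa using congrArg norm hr
    rw [Complex.star_def, Complex.mul_conj, Complex.normSq_eq_norm_sq, h2]
    simp
  have h3 : g.1 = r • (1 : Matrix (Fin 2) (Fin 2) ℂ) := by
    rw [← hg, Matrix.scalar_apply, Matrix.smul_one_eq_diagonal]
  rw [h3, Matrix.conjTranspose_smul, Matrix.conjTranspose_one, Matrix.smul_mul, Matrix.mul_smul,
    Matrix.smul_mul, Matrix.mul_one, Matrix.one_mul, smul_smul, mul_comm, h1, one_smul]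

/-- The action of `PSL₂(ℂ)` on `ℍ³`, by `A ↦ g A g*` for any lift of the group element to a matrix
`g` of determinant one. (The action of `PSL₂(ℂ)` on `ℂP¹` is the one of Mathlib.) -/
instance : MulAction PSL2C H3 :=
  MulAction.compHom H3
    (QuotientGroup.lift _ (MulAction.toPermHom (Matrix.SpecialLinearGroup (Fin 2) ℂ) H3)
      center_le_ker_toPermHom)

/-! ## Labels and shapes of ideal tetrahedra -/

/-- The edges of the standard tetrahedron with vertices `0, 1, 2, 3`. -/
abbrev TetEdge : Type := {s : Finset (Fin 4) // s.card = 2}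

/-- The standard labelling of the edges of the oriented tetrahedron by `z`, `z'`, `z''`
(written `0`, `1`, `2`): opposite edges have the same label. -/
def label (s : Finset (Fin 4)) : Fin 3 :=
  if s = {0, 1} ∨ s = {2, 3} then 0
  else if s = {1, 2} ∨ s = {0, 3} then 1
  else 2

/-- The point `w ∈ ℂ ⊂ ℂP¹`. -/
noncomputable def finitePt (w : ℂ) : Ideal3 :=
  Projectivization.mk ℂ ![w, 1] (fun h => one_ne_zero (α := ℂ) (by simpa using congrFun h 1))

/-- The point `∞ ∈ ℂP¹`. -/
noncomputable def inftyPt : Ideal3 :=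
  Projectivization.mk ℂ ![1, 0] (fun h => one_ne_zero (α := ℂ) (by simpa using congrFun h 0))

/-- The ordered ideal vertices `(0, ∞, 1, w)`: the standard ideal tetrahedron with shape parameter
`w` at its edge `(0, ∞)`. -/
noncomputable def stdVertices (w : ℂ) : Fin 4 → Ideal3 := ![finitePt 0, inftyPt, finitePt 1, finitePt w]

/-- The ideal hyperbolic tetrahedron with ordered ideal vertices `v 0, v 1, v 2, v 3` has the shape
`z = (z, z', z'')`: for every orientation preserving reordering `(a, b, c, d)` of the vertices, an
orientation preserving isometry takes `(v a, v b, v c, v d)` to `(0, ∞, 1, w)`, where `w` is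
the label of the edge `ab`. -/
def HasShape (v : Fin 4 → Ideal3) (z : Fin 3 → ℂ) : Prop :=
  ∀ e : Equiv.Perm (Fin 4), Equiv.Perm.sign e = 1 →
    ∃ g : PSL2C, ∀ k, g • v (e k) = stdVertices (z (label {e 0, e 1})) k

/-! ## Ideal simplices and straight maps -/

/-- The standard ideal 3-simplex: the standard 3-simplex with its vertices removed. -/
def IdealSimplex : Type := {t : Fin 4 → ℝ // t ∈ stdSimplex ℝ (Fin 4) ∧ ∀ k, t k ≠ 1}

instance : TopologicalSpace IdealSimplex :=
  inferInstanceAs (TopologicalSpace {t : Fin 4 → ℝ // t ∈ stdSimplex ℝ (Fin 4) ∧ ∀ k, t k ≠ 1})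

/-- The isometry of the ideal simplex that permutes the vertices by `g`. -/
def IdealSimplex.permute (g : Equiv.Perm (Fin 4)) (t : IdealSimplex) : IdealSimplex :=
  ⟨fun k => t.1 (g.symm k), ⟨fun k => t.2.1.1 _, by
    rw [Equiv.sum_comp g.symm t.1]
    exact t.2.1.2⟩, fun k => t.2.2 _⟩

/-- The point of the closed standard simplex given by a point of the ideal simplex. -/
def IdealSimplex.toSimplex (t : IdealSimplex) : stdSimplex ℝ (Fin 4) := ⟨t.1, t.2.1⟩

/-- `σ` is a straight map of the ideal simplex to hyperbolic space with ideal vertices `v`: up to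
a parametrization, that is, a homeomorphism `f` of the simplex preserving each of its faces, it is
the straight (projective) map of the hyperboloid model sending `t` to the point of `ℍ³` on the ray
through `∑ k, t k • (u k) (u k)*`, where the vector `u k ∈ ℂ²` represents `v k`. Hence `σ` maps each
ideal face of the simplex onto the ideal hyperbolic simplex spanned by the corresponding `v k`. -/
def IsStraight (v : Fin 4 → Ideal3) (σ : IdealSimplex → H3) : Prop :=
  ∃ u : Fin 4 → Fin 2 → ℂ,
    (∀ k, ∃ hk : u k ≠ 0, Projectivization.mk ℂ (u k) hk = v k) ∧
    ∃ f : stdSimplex ℝ (Fin 4) ≃ₜ stdSimplex ℝ (Fin 4),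
      (∀ t k, (f t).1 k = 0 ↔ t.1 k = 0) ∧
      ∀ t : IdealSimplex, ∃ r : ℝ, 0 < r ∧
        (σ t).1 = (r : ℂ) • ∑ k, ((f t.toSimplex).1 k : ℂ) • Matrix.vecMulVec (u k) (star (u k))

/-! ## Ideal triangulations and the hyperbolic gluing equations -/

/-- One step of the identification of oriented edges `(i, a, b)` (the edge from the vertex `a` to
the vertex `b` of the tetrahedron `i`) under given face pairings. -/
inductive OrientedEdgeStep {ι : Type*} (adj : ι → Fin 4 → ι)
    (glue : ι → Fin 4 → Equiv.Perm (Fin 4)) : ι × Fin 4 × Fin 4 → ι × Fin 4 × Fin 4 → Prop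
  | step (i : ι) (f a b : Fin 4) (ha : a ≠ f) (hb : b ≠ f) :
      OrientedEdgeStep adj glue (i, a, b) (adj i f, glue i f a, glue i f b)

/-- An oriented ideal triangulation with set of tetrahedra `ι`. Each tetrahedron is identified with
the standard oriented simplex. The face of the tetrahedron `i` opposite to its vertex `f` is
paired with a face of the tetrahedron `adj i f`; the isometry between the two faces is given by
the vertex bijection `glue i f`, where `glue i f f` is by convention the vertex opposite to the
target face. -/
structure IdealTriangulation (ι : Type*) where
  adj : ι → Fin 4 → ι
  glue : ι → Fin 4 → Equiv.Perm (Fin 4)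
  /-- The face pairings come in mutually inverse pairs. -/
  adj_adj : ∀ i f, adj (adj i f) (glue i f f) = i
  glue_glue : ∀ i f, glue (adj i f) (glue i f f) = (glue i f)⁻¹
  /-- No face is paired with itself. -/
  pairing_ne : ∀ i f, ¬ (adj i f = i ∧ glue i f f = f)
  /-- The face pairings reverse the induced orientations of the faces: the quotient is oriented. -/
  glue_odd : ∀ i f, Equiv.Perm.sign (glue i f) = -1
  /-- No edge is identified with itself with reversed orientation, that is, open edges are
  embedded in the quotient. This is the condition for the quotient (without the vertices) to be
  a 3-manifold: without it, the midpoint of such an edge has a projective plane as its link. -/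
  edge_not_reversed : ∀ i a b, a ≠ b →
    ¬ Relation.EqvGen (OrientedEdgeStep adj glue) (i, a, b) (i, b, a)

namespace IdealTriangulation

variable {ι : Type*} (T : IdealTriangulation ι)

/-- The identification of points of the ideal simplices by the face pairings. -/
inductive FacePairing : (Σ _ : ι, IdealSimplex) → (Σ _ : ι, IdealSimplex) → Prop
  | pair (i : ι) (f : Fin 4) (t : IdealSimplex) (ht : t.1 f = 0) :
      FacePairing ⟨i, t⟩ ⟨T.adj i f, t.permute (T.glue i f)⟩

/-- The ideally triangulated space `N`: the quotient of the disjoint union of the ideal simplices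
by the face pairings. -/
def Space : Type _ := Quot T.FacePairing

instance : TopologicalSpace T.Space := inferInstanceAs (TopologicalSpace (Quot T.FacePairing))

/-- The characteristic map of the ideal tetrahedron `i` of `N`. -/
def char (i : ι) (t : IdealSimplex) : T.Space := Quot.mk _ ⟨i, t⟩

/-- One step of the identification of (unoriented) edges of the tetrahedra by the face pairings. -/
inductive EdgeStep : ι × TetEdge → ι × TetEdge → Prop
  | step (i : ι) (f : Fin 4) (s : TetEdge) (hs : f ∉ s.1) :
      EdgeStep (i, s) (T.adj i f, ⟨s.1.map (T.glue i f).toEmbedding, by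
        rw [Finset.card_map]
        exact s.2⟩)

/-- The edges of the ideal triangulation. -/
def Edge : Type _ := Quot T.EdgeStep

/-- The number of edges of the tetrahedron `i` with label `k` that map to the edge `e`. -/
noncomputable def edgeCount (i : ι) (k : Fin 3) (e : T.Edge) : ℕ :=
  Nat.card {s : TetEdge // label s.1 = k ∧ Quot.mk T.EdgeStep (i, s) = e}

/-- The deformation variety: the solutions `Z = (z_i, z_i', z_i'')` of the parameter relations and of
the hyperbolic gluing equations. -/
def deformationVariety [Fintype ι] : Set (ι → Fin 3 → ℂ) :=
  {Z | (∀ i k, Z i k ≠ 0) ∧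
    (∀ i, Z i 0 * (1 - Z i 2) = 1 ∧ Z i 1 * (1 - Z i 0) = 1 ∧ Z i 2 * (1 - Z i 1) = 1) ∧
    ∀ e : T.Edge, ∏ i, ∏ k, Z i k ^ T.edgeCount i k e = 1}

/-- `τ` is an ideal tetrahedron of a covering space `p : E → N` over the tetrahedron `i` of `N`:
a lift of the characteristic map of `i`. -/
def IsLift {E : Type*} [TopologicalSpace E] (p : E → T.Space) (i : ι) (τ : IdealSimplex → E) :
    Prop :=
  Continuous τ ∧ ∀ t, p (τ t) = T.char i t

/-- A pseudo-developing map for the shape parameters `Z`: a continuous map from the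
covering space `E` of `N` to `ℍ³` that maps every ideal tetrahedron of `E` by a straight map to an
ideal hyperbolic tetrahedron of the shape prescribed by `Z`. -/
structure IsPseudoDeveloping {E : Type*} [TopologicalSpace E] (p : E → T.Space)
    (Z : ι → Fin 3 → ℂ) (Φ : E → H3) : Prop where
  continuous : Continuous Φ
  straight : ∀ (i : ι) (τ : IdealSimplex → E), T.IsLift p i τ →
    ∃ v : Fin 4 → Ideal3, HasShape v (Z i) ∧ IsStraight v (Φ ∘ τ)

end IdealTriangulation

/-- The map `Φ : E → ℍ³` is equivariant with respect to the representation `ρ` of `π₁(X, p x₀)`,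
where `p : E → X` is a universal covering. The element `γ` acts on `E` by the unique deck
transformation `h` for which `h x₀` is the end point of the lift of `γ⁻¹` that starts at `x₀`; the
inverse is there because the product `γ * δ` of Mathlib's fundamental group is the class of the
concatenation of first `δ` and then `γ`, so that this is a left action. -/
def IsEquivariant {E X : Type*} [TopologicalSpace E] [TopologicalSpace X] {p : E → X}
    (hp : IsCoveringMap p) (x₀ : E) (Φ : E → H3) (ρ : FundamentalGroup X (p x₀) →* PSL2C) : Prop :=
  ∀ γ : FundamentalGroup X (p x₀), ∃ h : E ≃ₜ E,
    (∀ x, p (h x) = p x) ∧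
    h x₀ = (hp.monodromy (FundamentalGroup.toPath γ⁻¹) ⟨x₀, rfl⟩ : p ⁻¹' {p x₀}) ∧
    ∀ x, Φ (h x) = ρ γ • Φ x

end IdealHyp

namespace IdealHyp

open scoped LinearAlgebra.Projectivization ComplexOrder

/-! ## The action of `PSL₂(ℂ)` on the projective line -/

/-! The idea is to glue all possible developments of all tetrahedra into one covering space of `N`.
A point of `Developed Z` is a tetrahedron `i` of `N` together with an ideal hyperbolic tetrahedron
of shape `Z i`. Three ideal vertices and the shape determine the fourth vertex, so each such pair
has a unique neighbour across each face. These neighbours form the ideal triangulation `developed`,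
on which `PSL2C` acts, simply transitively on the tetrahedra over a given `i`.

The quotient of the developed space by `PSL2C` is `N`. Normalize an edge to run from 0 to ∞: turning
past one tetrahedron multiplies the next vertex by the label of the edge. The gluing equations
therefore say that a full turn around an edge closes up, so the action is free on edges
(`eq_of_developedEdgeRel`). As the vertices are removed, every point lies in the open star of a cell
with trivial stabilizer, and the projection is a covering with group `PSL2C`
(`isQuotientCoveringMap_developedProj`). The universal covering lifts to the developed space by a
map `F`; comparing `F` with its composites with deck transformations yields `ρ`, and choosing the
value of `F` at one point prescribes the image of one tetrahedron.

It remains to map the developed space to `H3` equivariantly, continuously and by straight maps.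
Light-like vectors at the ideal vertices cannot in general be chosen equivariantly, because the
holonomy at an ideal vertex may rescale them. They can be chosen at oriented edges, where the action
is free (`edgeLight`). A point with coordinates `t` goes to the ray of the sum of `t k ^ 2 * t l`
times the vector of the edge `(k, l)` at its origin. This agrees on common faces, and on each
tetrahedron it is straight after a change of coordinates by cubic weights, which is a face
preserving homeomorphism (`reparam`).

For uniqueness, limits along edges recover the ideal vertices from a straight map
(`IsStraight.vertex_eq`). An isometry that matches the vertices of one tetrahedron matches three
vertices of each neighbour, hence all four, and by connectedness it works everywhere
(`exists_movesVertices_all`). -/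

theorem psl_mk_smul_mk (g : Matrix.SpecialLinearGroup (Fin 2) ℂ) (u : Fin 2 → ℂ) (hu : u ≠ 0) :
    ∃ h : g.1.mulVec u ≠ 0,
      (QuotientGroup.mk g : PSL2C) • Projectivization.mk ℂ u hu
        = Projectivization.mk ℂ (g.1.mulVec u) h := by
  have h : g.1.mulVec u ≠ 0 := by
    intro h0
    apply hu
    have hdet : IsUnit g.1.det := by rw [g.2]; exact isUnit_one
    have := congrArg (g.1⁻¹.mulVec) h0
    rwa [Matrix.mulVec_mulVec, Matrix.nonsing_inv_mul _ hdet, Matrix.one_mulVec,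
      Matrix.mulVec_zero] at this
  exact ⟨h, rfl⟩

theorem mk_eq_mk_of_smul {u v : Fin 2 → ℂ} (hu : u ≠ 0) (hv : v ≠ 0) (a : ℂ) (h : a • v = u) :
    Projectivization.mk ℂ u hu = Projectivization.mk ℂ v hv :=
  (Projectivization.mk_eq_mk_iff' ℂ u v hu hv).2 ⟨a, h⟩

/-- A matrix with nonzero determinant acts on the projective line as an element of `PSL₂(ℂ)`. -/
theorem exists_psl_of_det_ne_zero (M : Matrix (Fin 2) (Fin 2) ℂ) (hM : M.det ≠ 0) :
    ∃ g : PSL2C, ∀ (u v : Fin 2 → ℂ) (hu : u ≠ 0) (hv : v ≠ 0) (a : ℂ), M.mulVec u = a • v →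
      g • Projectivization.mk ℂ u hu = Projectivization.mk ℂ v hv := by
  obtain ⟨s, hs⟩ : ∃ s : ℂ, s ^ 2 = M.det⁻¹ := IsAlgClosed.exists_pow_nat_eq _ (by norm_num)
  have hdet : (s • M).det = 1 := by
    rw [Matrix.det_smul, Fintype.card_fin, hs, inv_mul_cancel₀ hM]
  refine ⟨QuotientGroup.mk ⟨s • M, hdet⟩, fun u v hu hv a h => ?_⟩
  obtain ⟨h', he⟩ := psl_mk_smul_mk ⟨s • M, hdet⟩ u hu
  rw [he]
  refine mk_eq_mk_of_smul _ _ (s * a) ?_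
  change _ = (s • M).mulVec u
  rw [Matrix.smul_mulVec, h, smul_smul]

theorem ideal_cases (p : Ideal3) : p = inftyPt ∨ ∃ w, p = finitePt w := by
  induction p using Projectivization.ind with
  | h u hu =>
    by_cases h1 : u 1 = 0
    · left
      refine mk_eq_mk_of_smul _ _ (u 0) ?_
      ext i
      fin_cases i <;> simp [h1]
    · right
      refine ⟨u 0 / u 1, mk_eq_mk_of_smul _ _ (u 1) ?_⟩
      ext i
      fin_cases i
      · simp
        field_simp
      · simp

theorem finitePt_ne_inftyPt (w : ℂ) : finitePt w ≠ inftyPt := by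
  intro h
  obtain ⟨a, ha⟩ := (Projectivization.mk_eq_mk_iff' ℂ _ _ _ _).1 h
  simpa using congrFun ha 1

theorem finitePt_injective : Function.Injective finitePt := by
  intro w w' h
  obtain ⟨a, ha⟩ := (Projectivization.mk_eq_mk_iff' ℂ _ _ _ _).1 h
  have h1 : a = 1 := by simpa using congrFun ha 1
  have h0 := congrFun ha 0
  simp [h1] at h0
  exact h0.symm

theorem det_ne_zero_of_mk_ne {x y : Fin 2 → ℂ} (hx : x ≠ 0) (hy : y ≠ 0)
    (hne : Projectivization.mk ℂ x hx ≠ Projectivization.mk ℂ y hy) :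
    x 0 * y 1 - x 1 * y 0 ≠ 0 := by
  intro h0
  apply hne
  by_cases hy1 : y 1 = 0
  · have hy0 : y 0 ≠ 0 := by
      intro h
      apply hy
      ext i
      fin_cases i <;> simp [h, hy1]
    refine mk_eq_mk_of_smul _ _ (x 0 / y 0) ?_
    have hx1 : x 1 = 0 := by simpa [hy1, hy0] using h0
    ext i
    fin_cases i
    · simp
      field_simp
    · simp [hy1, hx1]
  · refine mk_eq_mk_of_smul _ _ (x 1 / y 1) ?_
    ext i
    fin_cases i
    · simp
      field_simp
      linear_combination -h0
    · simp
      field_simp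

/-- `PSL₂(ℂ)` is transitive on triples of distinct points of the projective line. -/
theorem exists_psl_std {p q r : Ideal3} (hpq : p ≠ q) (hpr : p ≠ r) (hqr : q ≠ r) :
    ∃ g : PSL2C, g • p = finitePt 0 ∧ g • q = inftyPt ∧ g • r = finitePt 1 := by
  induction p using Projectivization.ind with
  | h u hu =>
  induction q using Projectivization.ind with
  | h v hv =>
  induction r using Projectivization.ind with
  | h w hw =>
  have huv := det_ne_zero_of_mk_ne hu hv hpq
  have huw := det_ne_zero_of_mk_ne hu hw hpr
  have hvw := det_ne_zero_of_mk_ne hv hw hqr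
  set duv := u 0 * v 1 - u 1 * v 0 with hduv
  set duw := u 0 * w 1 - u 1 * w 0 with hduw
  set dvw := v 0 * w 1 - v 1 * w 0 with hdvw
  -- The matrix takes `x` to `(dvw * det (u, x), duw * det (v, x))`: the cross ratio with zero at
  -- `u`, pole at `v` and value one at `w`.
  obtain ⟨g, hg⟩ := exists_psl_of_det_ne_zero
    !![-(dvw * u 1), dvw * u 0; -(duw * v 1), duw * v 0] (by
      rw [Matrix.det_fin_two_of]
      have : -(dvw * u 1) * (duw * v 0) - dvw * u 0 * -(duw * v 1) = dvw * duw * duv := by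
        rw [hduv]; ring
      rw [this]
      exact mul_ne_zero (mul_ne_zero hvw huw) huv)
  refine ⟨g, hg _ _ _ _ (-(duw * duv)) ?_, hg _ _ _ _ (dvw * duv) ?_, hg _ _ _ _ (duw * dvw) ?_⟩
  all_goals
    ext i
    fin_cases i <;> simp [Matrix.mulVec, dotProduct, Fin.sum_univ_two, hduv, hduw, hdvw] <;> ring

/-- An element of `PSL₂(ℂ)` fixing `0` and `∞` acts as a homothety. -/
theorem smul_finitePt_of_fixes {g : PSL2C} (h0 : g • finitePt 0 = finitePt 0)
    (hi : g • inftyPt = inftyPt) : ∃ a : ℂ, a ≠ 0 ∧ ∀ w, g • finitePt w = finitePt (a * w) := by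
  induction g using QuotientGroup.induction_on with
  | H g =>
  obtain ⟨_, e0⟩ := psl_mk_smul_mk g ![0, 1] (fun h => one_ne_zero (α := ℂ) (by simpa using congrFun h 1))
  obtain ⟨_, ei⟩ := psl_mk_smul_mk g ![1, 0] (fun h => one_ne_zero (α := ℂ) (by simpa using congrFun h 0))
  obtain ⟨a, ha⟩ := (Projectivization.mk_eq_mk_iff' ℂ _ _ _ _).1 (e0.symm.trans h0)
  obtain ⟨b, hb⟩ := (Projectivization.mk_eq_mk_iff' ℂ _ _ _ _).1 (ei.symm.trans hi)
  have h01 : g.1 0 1 = 0 := by simpa [Matrix.mulVec, dotProduct, Fin.sum_univ_two] using (congrFun ha 0).symm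
  have h10 : g.1 1 0 = 0 := by simpa [Matrix.mulVec, dotProduct, Fin.sum_univ_two] using (congrFun hb 1).symm
  have hd : g.1 0 0 * g.1 1 1 = 1 := by
    have := g.2
    rw [Matrix.det_fin_two, h01] at this
    simpa using this
  have h00 : g.1 0 0 ≠ 0 := left_ne_zero_of_mul_eq_one hd
  have h11 : g.1 1 1 ≠ 0 := right_ne_zero_of_mul_eq_one hd
  refine ⟨g.1 0 0 / g.1 1 1, div_ne_zero h00 h11, fun w => ?_⟩
  obtain ⟨_, ew⟩ := psl_mk_smul_mk g ![w, 1] (fun h => one_ne_zero (α := ℂ) (by simpa using congrFun h 1))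
  refine ew.trans (mk_eq_mk_of_smul _ _ (g.1 1 1) ?_)
  ext i
  fin_cases i
  · simp [Matrix.mulVec, dotProduct, Fin.sum_univ_two, h01]
    field_simp
  · simp [Matrix.mulVec, dotProduct, Fin.sum_univ_two, h10]

theorem eq_one_of_fixes_std {g : PSL2C} (h0 : g • finitePt 0 = finitePt 0)
    (hi : g • inftyPt = inftyPt) (h1 : g • finitePt 1 = finitePt 1) : g = 1 := by
  obtain ⟨a, _, ha⟩ := smul_finitePt_of_fixes h0 hi
  have ha1 : a = 1 := by
    have := finitePt_injective ((ha 1).symm.trans h1)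
    simpa using this
  refine FaithfulSMul.eq_of_smul_eq_smul (α := Ideal3) fun p => ?_
  rw [one_smul]
  rcases ideal_cases p with rfl | ⟨w, rfl⟩
  · exact hi
  · rw [ha, ha1, one_mul]

/-- An element of `PSL₂(ℂ)` is determined by its values on three distinct points. -/
theorem psl_eq_of_smul_eq {p q r : Ideal3} (hpq : p ≠ q) (hpr : p ≠ r) (hqr : q ≠ r) {g h : PSL2C}
    (hp : g • p = h • p) (hq : g • q = h • q) (hr : g • r = h • r) : g = h := by
  obtain ⟨c, cp, cq, cr⟩ := exists_psl_std hpq hpr hqr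
  have conj : ∀ {x y : Ideal3}, c • x = y → g • x = h • x → (c * (h⁻¹ * g) * c⁻¹) • y = y := by
    rintro x y rfl hx
    rw [mul_smul, inv_smul_smul, mul_smul, mul_smul, hx, inv_smul_smul]
  have := eq_one_of_fixes_std (conj cp hp) (conj cq hq) (conj cr hr)
  rw [mul_inv_eq_one, mul_eq_left, inv_mul_eq_one] at this
  exact this.symm

theorem exists_psl_smul_eq {p q r p' q' r' : Ideal3} (hpq : p ≠ q) (hpr : p ≠ r) (hqr : q ≠ r)
    (hpq' : p' ≠ q') (hpr' : p' ≠ r') (hqr' : q' ≠ r') :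
    ∃ g : PSL2C, g • p = p' ∧ g • q = q' ∧ g • r = r' := by
  obtain ⟨c, cp, cq, cr⟩ := exists_psl_std hpq hpr hqr
  obtain ⟨d, dp, dq, dr⟩ := exists_psl_std hpq' hpr' hqr'
  refine ⟨d⁻¹ * c, ?_, ?_, ?_⟩
  · rw [mul_smul, cp, ← dp, inv_smul_smul]
  · rw [mul_smul, cq, ← dq, inv_smul_smul]
  · rw [mul_smul, cr, ← dr, inv_smul_smul]

/-! ## Tetrahedra of a given shape -/

/-- The relations between the three shape parameters of an ideal tetrahedron. -/
structure IsShape (z : Fin 3 → ℂ) : Prop where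
  ne_zero : ∀ k, z k ≠ 0
  rel₀ : z 0 * (1 - z 2) = 1
  rel₁ : z 1 * (1 - z 0) = 1
  rel₂ : z 2 * (1 - z 1) = 1

theorem IsShape.mul_succ {z : Fin 3 → ℂ} (hz : IsShape z) (m : Fin 3) :
    z (m + 1) * (1 - z m) = 1 := by
  fin_cases m
  · exact hz.rel₁
  · exact hz.rel₂
  · exact hz.rel₀

theorem IsShape.ne_one {z : Fin 3 → ℂ} (hz : IsShape z) (m : Fin 3) : z m ≠ 1 := by
  intro h
  have := hz.mul_succ m
  rw [h] at this
  simp at this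

theorem stdVertices_injective {w : ℂ} (h0 : w ≠ 0) (h1 : w ≠ 1) :
    Function.Injective (stdVertices w) := by
  have a : finitePt 0 ≠ finitePt 1 := finitePt_injective.ne zero_ne_one
  have b : finitePt 0 ≠ finitePt w := finitePt_injective.ne h0.symm
  have c : finitePt 1 ≠ finitePt w := finitePt_injective.ne h1.symm
  have d0 := finitePt_ne_inftyPt 0
  have d1 := finitePt_ne_inftyPt 1
  have dw := finitePt_ne_inftyPt w
  intro i j hij
  fin_cases i <;> fin_cases j <;> simp [stdVertices] at hij ⊢
  all_goals first
    | exact absurd hij a | exact absurd hij b | exact absurd hij c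
    | exact absurd hij d0 | exact absurd hij d1 | exact absurd hij dw
    | exact absurd hij.symm a | exact absurd hij.symm b | exact absurd hij.symm c
    | exact absurd hij.symm d0 | exact absurd hij.symm d1 | exact absurd hij.symm dw

/-- The even permutation fixing `0` that shifts the labels of the edges at `0`. -/
def shiftPerm : Equiv.Perm (Fin 4) :=
  ⟨![0, 3, 1, 2], ![0, 2, 3, 1], by decide, by decide⟩

/-- The double transposition exchanging the ends of the edges `01` and `23`. -/
def flipPerm : Equiv.Perm (Fin 4) :=
  ⟨![1, 0, 3, 2], ![1, 0, 3, 2], by decide, by decide⟩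

/-- The stabilizer of `0` in the alternating group is generated by `shiftPerm`. By 2-transitivity
its complement is a single double coset, that of `flipPerm`; the count is 3 + 9 = 12. -/
theorem even_perm_cases (e : Equiv.Perm (Fin 4)) (he : Equiv.Perm.sign e = 1) :
    ∃ i j : Fin 3, e = shiftPerm ^ i.1 ∨ e = shiftPerm ^ i.1 * flipPerm * shiftPerm ^ j.1 := by
  revert e
  decide +kernel

theorem label_shiftPerm (e : Equiv.Perm (Fin 4)) (he : Equiv.Perm.sign e = 1) :
    label {e (shiftPerm 0), e (shiftPerm 1)} = label {e 0, e 1} + 1 := by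
  revert e
  decide +kernel

theorem label_flipPerm (e : Equiv.Perm (Fin 4)) :
    label {e (flipPerm 0), e (flipPerm 1)} = label {e 0, e 1} := by
  revert e
  decide +kernel

/-- The Möbius map is `x ↦ x / (x - w)`. It fixes 0, takes `w` to ∞ and ∞ to 1, and takes 1 to `1 /
(1 - w) = w'`; the parameter relations express exactly this. -/
theorem exists_smul_std_shift {w w' : ℂ} (hw : w ≠ 0) (h : w' * (1 - w) = 1) :
    ∃ g : PSL2C, ∀ k, g • stdVertices w (shiftPerm k) = stdVertices w' k := by
  obtain ⟨g, hg⟩ := exists_psl_of_det_ne_zero !![1, 0; 1, -w] (by simpa using hw)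
  refine ⟨g, fun k => ?_⟩
  fin_cases k
  · refine hg _ _ _ _ (-w) ?_
    ext i; fin_cases i <;> simp [Matrix.mulVec, dotProduct, Fin.sum_univ_two]
  · refine hg _ _ _ _ w ?_
    ext i; fin_cases i <;> simp [Matrix.mulVec, dotProduct, Fin.sum_univ_two]
  · refine hg _ _ _ _ 1 ?_
    ext i; fin_cases i <;> simp [Matrix.mulVec, dotProduct, Fin.sum_univ_two]
  · refine hg _ _ _ _ (1 - w) ?_
    ext i; fin_cases i <;> simp [Matrix.mulVec, dotProduct, Fin.sum_univ_two]
    · linear_combination -h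
    · ring

/-- The Möbius map `x ↦ w / x` exchanges 0 with ∞ and 1 with `w`; so both ends of an edge see the
same parameter. -/
theorem exists_smul_std_flip {w : ℂ} (hw : w ≠ 0) :
    ∃ g : PSL2C, ∀ k, g • stdVertices w (flipPerm k) = stdVertices w k := by
  obtain ⟨g, hg⟩ := exists_psl_of_det_ne_zero !![0, w; 1, 0] (by simpa using hw)
  refine ⟨g, fun k => ?_⟩
  fin_cases k
  · refine hg _ _ _ _ 1 ?_
    ext i; fin_cases i <;> simp [Matrix.mulVec, dotProduct, Fin.sum_univ_two]
  · refine hg _ _ _ _ w ?_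
    ext i; fin_cases i <;> simp [Matrix.mulVec, dotProduct, Fin.sum_univ_two]
  · refine hg _ _ _ _ w ?_
    ext i; fin_cases i <;> simp [Matrix.mulVec, dotProduct, Fin.sum_univ_two]
  · refine hg _ _ _ _ 1 ?_
    ext i; fin_cases i <;> simp [Matrix.mulVec, dotProduct, Fin.sum_univ_two]

/-- The condition holds trivially for the identity ordering and is preserved under right
multiplication by the two generators of the alternating group. -/
theorem hasShape_stdVertices {z : Fin 3 → ℂ} (hz : IsShape z) : HasShape (stdVertices (z 0)) z := by
  let P : Equiv.Perm (Fin 4) → Prop := fun e =>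
    ∃ g : PSL2C, ∀ k, g • stdVertices (z 0) (e k) = stdVertices (z (label {e 0, e 1})) k
  have shift : ∀ e, Equiv.Perm.sign e = 1 → P e → P (e * shiftPerm) := by
    rintro e he ⟨g, hg⟩
    obtain ⟨h, hh⟩ := exists_smul_std_shift (hz.ne_zero (label {e 0, e 1}))
      (hz.mul_succ (label {e 0, e 1}))
    refine ⟨h * g, fun k => ?_⟩
    rw [mul_smul, Equiv.Perm.mul_apply, hg, hh, Equiv.Perm.mul_apply, Equiv.Perm.mul_apply,
      label_shiftPerm e he]
  have flip : ∀ e, P e → P (e * flipPerm) := by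
    rintro e ⟨g, hg⟩
    obtain ⟨h, hh⟩ := exists_smul_std_flip (hz.ne_zero (label {e 0, e 1}))
    refine ⟨h * g, fun k => ?_⟩
    rw [mul_smul, Equiv.Perm.mul_apply, hg, hh, Equiv.Perm.mul_apply, Equiv.Perm.mul_apply,
      label_flipPerm e]
  have sshift : Equiv.Perm.sign shiftPerm = 1 := by decide +kernel
  have sflip : Equiv.Perm.sign flipPerm = 1 := by decide +kernel
  have pow : ∀ (n : ℕ) e, Equiv.Perm.sign e = 1 → P e → P (e * shiftPerm ^ n) := by
    intro n
    induction n with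
    | zero => intro e _ h; simpa using h
    | succ n ih =>
      intro e he h
      rw [pow_succ, ← mul_assoc]
      exact shift _ (by simp [he, sshift]) (ih e he h)
  have one : P 1 := ⟨1, fun k => by simp [label]⟩
  intro e he
  obtain ⟨i, j, h | h⟩ := even_perm_cases e he
  · have := pow i.1 1 (by simp) one
    rw [one_mul, ← h] at this
    exact this
  · have := pow j.1 _ (by simp [sshift, sflip]) (flip _ (pow i.1 1 (by simp) one))
    rw [one_mul, ← h] at this
    exact this

theorem HasShape.exists_std {v : Fin 4 → Ideal3} {z : Fin 3 → ℂ} (h : HasShape v z) :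
    ∃ g : PSL2C, ∀ k, g • v k = stdVertices (z 0) k := by
  obtain ⟨g, hg⟩ := h 1 (by simp)
  exact ⟨g, fun k => by simpa [label] using hg k⟩

theorem HasShape.smul {v : Fin 4 → Ideal3} {z : Fin 3 → ℂ} (h : HasShape v z) (g : PSL2C) :
    HasShape (g • v) z := by
  intro e he
  obtain ⟨c, hc⟩ := h e he
  refine ⟨c * g⁻¹, fun k => ?_⟩
  rw [Pi.smul_apply, mul_smul, inv_smul_smul, hc]

theorem HasShape.injective {v : Fin 4 → Ideal3} {z : Fin 3 → ℂ} (h : HasShape v z)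
    (hz : IsShape z) : Function.Injective v := by
  obtain ⟨g, hg⟩ := h.exists_std
  intro a b hab
  apply stdVertices_injective (hz.ne_zero 0) (hz.ne_one 0)
  rw [← hg, ← hg, hab]

theorem HasShape.exists_smul_eq {v w : Fin 4 → Ideal3} {z : Fin 3 → ℂ} (hv : HasShape v z)
    (hw : HasShape w z) : ∃ g : PSL2C, w = g • v := by
  obtain ⟨g, hg⟩ := hv.exists_std
  obtain ⟨h, hh⟩ := hw.exists_std
  refine ⟨h⁻¹ * g, funext fun k => ?_⟩
  rw [Pi.smul_apply, mul_smul, hg, ← hh, inv_smul_smul]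

theorem exists_three (f : Fin 4) : ∃ a b c : Fin 4, a ≠ b ∧ a ≠ c ∧ b ≠ c ∧ a ≠ f ∧ b ≠ f ∧ c ≠ f ∧
    ∀ k, k ≠ f → k = a ∨ k = b ∨ k = c := by
  revert f
  decide

theorem psl_eq_of_smul_face_eq {v : Fin 4 → Ideal3} (hv : Function.Injective v) (f : Fin 4)
    {g h : PSL2C} (H : ∀ k, k ≠ f → g • v k = h • v k) : g = h := by
  obtain ⟨a, b, c, hab, hac, hbc, ha, hb, hc, -⟩ := exists_three f
  exact psl_eq_of_smul_eq (hv.ne hab) (hv.ne hac) (hv.ne hbc) (H a ha) (H b hb) (H c hc)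

theorem psl_eq_of_smul_vertices_eq {v : Fin 4 → Ideal3} (hv : Function.Injective v)
    {g h : PSL2C} (H : g • v = h • v) : g = h :=
  psl_eq_of_smul_face_eq hv 0 fun k _ => congrFun H k

/-- A tetrahedron of given shape is determined by the vertices of a face. -/
theorem HasShape.eq_of_face {v w : Fin 4 → Ideal3} {z : Fin 3 → ℂ} (hz : IsShape z)
    (hv : HasShape v z) (hw : HasShape w z) (f : Fin 4) (H : ∀ k, k ≠ f → v k = w k) : v = w := by
  obtain ⟨g, rfl⟩ := hv.exists_smul_eq hw
  have : g = 1 := psl_eq_of_smul_face_eq (hv.injective hz) f fun k hk => by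
    rw [one_smul]; exact (H k hk).symm
  rw [this, one_smul]

/-- A face extends to a tetrahedron of given shape. -/
theorem exists_hasShape_of_face {v : Fin 4 → Ideal3} (hv : Function.Injective v) {z : Fin 3 → ℂ}
    (hz : IsShape z) (f : Fin 4) : ∃ w, HasShape w z ∧ ∀ k, k ≠ f → w k = v k := by
  obtain ⟨a, b, c, hab, hac, hbc, -, -, -, h⟩ := exists_three f
  have hs := hasShape_stdVertices hz
  have hi := hs.injective hz
  obtain ⟨g, ga, gb, gc⟩ := exists_psl_smul_eq (hi.ne hab) (hi.ne hac) (hi.ne hbc)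
    (hv.ne hab) (hv.ne hac) (hv.ne hbc)
  refine ⟨_, hs.smul g, fun k hk => ?_⟩
  rcases h k hk with rfl | rfl | rfl
  · exact ga
  · exact gb
  · exact gc

/-! ## Flags of an ideal triangulation and the cycles of tetrahedra around its edges -/

/-- Even orderings of the vertices of a tetrahedron. -/
abbrev EvenOrder : Type := {e : Equiv.Perm (Fin 4) // Equiv.Perm.sign e = 1}

theorem exists_evenOrder {a b : Fin 4} (h : a ≠ b) : ∃ e : EvenOrder, e.1 0 = a ∧ e.1 1 = b := by
  have : ∀ a b : Fin 4, a ≠ b →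
      ∃ e : Equiv.Perm (Fin 4), Equiv.Perm.sign e = 1 ∧ e 0 = a ∧ e 1 = b := by decide +kernel
  obtain ⟨e, he, h⟩ := this a b h
  exact ⟨⟨e, he⟩, h⟩

theorem evenOrder_ext {e e' : EvenOrder} (h0 : e.1 0 = e'.1 0) (h1 : e.1 1 = e'.1 1) : e = e' := by
  have : ∀ e : Equiv.Perm (Fin 4), Equiv.Perm.sign e = 1 → e 0 = 0 → e 1 = 1 → e = 1 := by
    decide +kernel
  have h := this (e'.1⁻¹ * e.1) (by simp [e.2, e'.2]) (by simp [h0]) (by simp [h1])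
  exact Subtype.ext (inv_mul_eq_one.1 h).symm

theorem evenOrder_face (e : EvenOrder) (f : Fin 4) (h0 : e.1 0 ≠ f) (h1 : e.1 1 ≠ f) :
    f = e.1 2 ∨ f = e.1 3 := by
  obtain ⟨m, rfl⟩ := e.1.surjective f
  fin_cases m
  · exact absurd rfl h0
  · exact absurd rfl h1
  · exact Or.inl rfl
  · exact Or.inr rfl

namespace IdealTriangulation

variable {ι : Type*} (T : IdealTriangulation ι)

theorem glue_glue_apply (i : ι) (f k : Fin 4) :
    T.glue (T.adj i f) (T.glue i f f) (T.glue i f k) = k := by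
  rw [T.glue_glue]; simp

instance : Std.Symm (OrientedEdgeStep T.adj T.glue) where
  symm := by
    rintro _ _ ⟨i, f, a, b, ha, hb⟩
    have := OrientedEdgeStep.step (adj := T.adj) (glue := T.glue) (T.adj i f) (T.glue i f f)
      (T.glue i f a) (T.glue i f b) ((T.glue i f).injective.ne ha) ((T.glue i f).injective.ne hb)
    rwa [T.adj_adj, T.glue_glue_apply, T.glue_glue_apply] at this

/-- One step of the identification of faces of arbitrary dimension of the tetrahedra. -/
inductive CellStep : ι × Finset (Fin 4) → ι × Finset (Fin 4) → Prop
  | step (i : ι) (f : Fin 4) (s : Finset (Fin 4)) (hs : f ∉ s) :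
      CellStep (i, s) (T.adj i f, s.map (T.glue i f).toEmbedding)

instance : Std.Symm T.CellStep where
  symm := by
    rintro _ _ ⟨i, f, s, hs⟩
    have := CellStep.step (T := T) (T.adj i f) (T.glue i f f) (s.map (T.glue i f).toEmbedding)
      (by simpa using hs)
    rw [T.adj_adj, T.glue_glue, Finset.map_map] at this
    have h : (T.glue i f).toEmbedding.trans (T.glue i f)⁻¹.toEmbedding
        = Function.Embedding.refl _ := by
      ext x; simp
    rwa [h, Finset.map_refl] at this

theorem card_eq_of_eqvGen_cellStep {x y : ι × Finset (Fin 4)}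
    (h : Relation.EqvGen T.CellStep x y) : x.2.card = y.2.card := by
  induction h with
  | rel x y h => obtain ⟨i, f, s, hs⟩ := h; simp
  | refl => rfl
  | symm _ _ _ ih => exact ih.symm
  | trans _ _ _ _ _ ih ih' => exact ih.trans ih'

/-- Turning around the edge `e 0, e 1` of the tetrahedron `i`, across the face opposite to `e 2`. -/
def turnFun (q : ι × EvenOrder) : ι × EvenOrder :=
  (T.adj q.1 (q.2.1 2), ⟨T.glue q.1 (q.2.1 2) * q.2.1 * Equiv.swap 2 3, by
    rw [map_mul, map_mul, T.glue_odd, q.2.2, Equiv.Perm.sign_swap (by decide)]; rfl⟩)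

/-- Turning back, across the face opposite to `e 3`. -/
def turnInvFun (q : ι × EvenOrder) : ι × EvenOrder :=
  (T.adj q.1 (q.2.1 3), ⟨T.glue q.1 (q.2.1 3) * q.2.1 * Equiv.swap 2 3, by
    rw [map_mul, map_mul, T.glue_odd, q.2.2, Equiv.Perm.sign_swap (by decide)]; rfl⟩)

/-- Turning around the edges. -/
def turn : Equiv.Perm (ι × EvenOrder) where
  toFun := T.turnFun
  invFun := T.turnInvFun
  left_inv q := by
    have h3 : (T.glue q.1 (q.2.1 2) * q.2.1 * Equiv.swap 2 3 : Equiv.Perm (Fin 4)) 3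
        = T.glue q.1 (q.2.1 2) (q.2.1 2) := by simp
    refine Prod.ext ?_ (Subtype.ext ?_)
    · simp only [turnFun, turnInvFun, h3, T.adj_adj]
    · simp only [turnFun, turnInvFun, h3, T.glue_glue]
      rw [mul_assoc _ q.2.1, inv_mul_cancel_left, mul_assoc, Equiv.swap_mul_self, mul_one]
  right_inv q := by
    have h3 : (T.glue q.1 (q.2.1 3) * q.2.1 * Equiv.swap 2 3 : Equiv.Perm (Fin 4)) 2
        = T.glue q.1 (q.2.1 3) (q.2.1 3) := by simp
    refine Prod.ext ?_ (Subtype.ext ?_)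
    · simp only [turnFun, turnInvFun, h3, T.adj_adj]
    · simp only [turnFun, turnInvFun, h3, T.glue_glue]
      rw [mul_assoc _ q.2.1, inv_mul_cancel_left, mul_assoc, Equiv.swap_mul_self, mul_one]

/-- The oriented edge of a flag. -/
def flagEdge (q : ι × EvenOrder) : ι × Fin 4 × Fin 4 := (q.1, q.2.1 0, q.2.1 1)

theorem flagEdge_injective : Function.Injective (flagEdge (ι := ι)) := by
  rintro ⟨i, e⟩ ⟨j, e'⟩ h
  simp only [flagEdge, Prod.mk.injEq] at h
  exact Prod.ext h.1 (evenOrder_ext h.2.1 h.2.2)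

theorem swap_two_three_zero : Equiv.swap (2 : Fin 4) 3 0 = 0 := by decide

theorem swap_two_three_one : Equiv.swap (2 : Fin 4) 3 1 = 1 := by decide

theorem flagEdge_turn (q : ι × EvenOrder) :
    flagEdge (T.turn q) = (T.adj q.1 (q.2.1 2), T.glue q.1 (q.2.1 2) (q.2.1 0),
      T.glue q.1 (q.2.1 2) (q.2.1 1)) := by
  simp [flagEdge, turn, turnFun, swap_two_three_zero, swap_two_three_one]

theorem flagEdge_turn_symm (q : ι × EvenOrder) :
    flagEdge (T.turn.symm q) = (T.adj q.1 (q.2.1 3), T.glue q.1 (q.2.1 3) (q.2.1 0),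
      T.glue q.1 (q.2.1 3) (q.2.1 1)) := by
  simp [flagEdge, turn, turnInvFun, swap_two_three_zero, swap_two_three_one]

theorem eqvGen_flagEdge_turn_pow (q : ι × EvenOrder) (n : ℕ) :
    Relation.EqvGen (OrientedEdgeStep T.adj T.glue) (flagEdge q) (flagEdge (T.turn^[n] q)) := by
  induction n with
  | zero => exact .refl _
  | succ n ih =>
    refine ih.trans _ _ _ (.rel _ _ ?_)
    rw [Function.iterate_succ_apply', flagEdge_turn]
    exact .step _ _ _ _ (by simp) (by simp)

/-- Only two faces of a tetrahedron contain a given edge, those opposite to `e 2` and `e 3`.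
Crossing them is `turn` and its inverse, so a class of oriented edges is a single cycle of `turn`.
-/
theorem exists_sameCycle_of_eqvGen_orientedEdgeStep {x y : ι × Fin 4 × Fin 4}
    (h : Relation.EqvGen (OrientedEdgeStep T.adj T.glue) x y) :
    ∀ q, flagEdge q = x → ∃ q', T.turn.SameCycle q q' ∧ flagEdge q' = y := by
  rw [Relation.EqvGen.eqvGen_eq_reflTransGen] at h
  induction h with
  | refl => exact fun q hq => ⟨q, .refl _ _, hq⟩
  | tail _ h ih =>
    intro q hq
    obtain ⟨q', hq', h'⟩ := ih q hq
    obtain ⟨i, f, a, b, ha, hb⟩ := h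
    obtain ⟨j, e⟩ := q'
    simp only [flagEdge, Prod.mk.injEq] at h'
    obtain ⟨rfl, rfl, rfl⟩ := h'
    rcases evenOrder_face e f ha hb with rfl | rfl
    · exact ⟨_, Equiv.Perm.sameCycle_apply_right.2 hq', T.flagEdge_turn _⟩
    · exact ⟨_, Equiv.Perm.sameCycle_symm_apply_right.2 hq', T.flagEdge_turn_symm _⟩

theorem exists_sameCycle_of_eqvGen_cellStep {x y : ι × Finset (Fin 4)}
    (h : Relation.EqvGen T.CellStep x y) :
    ∀ q : ι × EvenOrder, q.1 = x.1 → {q.2.1 0, q.2.1 1} = x.2 →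
      ∃ q', T.turn.SameCycle q q' ∧ q'.1 = y.1 ∧ {q'.2.1 0, q'.2.1 1} = y.2 := by
  rw [Relation.EqvGen.eqvGen_eq_reflTransGen] at h
  induction h with
  | refl => exact fun q h1 h2 => ⟨q, .refl _ _, h1, h2⟩
  | tail _ h ih =>
    intro q h1 h2
    obtain ⟨⟨j, e⟩, hq', h', h''⟩ := ih q h1 h2
    obtain ⟨i, f, s, hs⟩ := h
    dsimp only at h' h''
    subst h' h''
    have hs0 : e.1 0 ≠ f := by rintro rfl; simp at hs
    have hs1 : e.1 1 ≠ f := by rintro rfl; simp at hs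
    rcases evenOrder_face e f hs0 hs1 with rfl | rfl
    · refine ⟨_, Equiv.Perm.sameCycle_apply_right.2 hq', ?_⟩
      simp [turn, turnFun, Finset.map_insert, swap_two_three_zero, swap_two_three_one]
    · refine ⟨_, Equiv.Perm.sameCycle_symm_apply_right.2 hq', ?_⟩
      simp [turn, turnInvFun, Finset.map_insert, swap_two_three_zero, swap_two_three_one]

/-- Two flags with the same unoriented edge agree or are reverses of each other. The second case
within one cycle would identify an edge with its own reverse. -/
theorem eq_of_iterate_turn_of_edge_eq (q : ι × EvenOrder) {m n : ℕ}
    (h1 : (T.turn^[m] q).1 = (T.turn^[n] q).1)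
    (h2 : ({(T.turn^[m] q).2.1 0, (T.turn^[m] q).2.1 1} : Finset (Fin 4))
      = {(T.turn^[n] q).2.1 0, (T.turn^[n] q).2.1 1}) : T.turn^[m] q = T.turn^[n] q := by
  have hm := T.eqvGen_flagEdge_turn_pow q m
  have hn := T.eqvGen_flagEdge_turn_pow q n
  generalize T.turn^[m] q = x at *
  generalize T.turn^[n] q = y at *
  obtain ⟨i, e⟩ := x
  obtain ⟨j, e'⟩ := y
  dsimp only at h1 h2
  subst h1
  have hne : e.1 0 ≠ e.1 1 := by simp
  have hcase : (e.1 0 = e'.1 0 ∧ e.1 1 = e'.1 1) ∨ (e.1 0 = e'.1 1 ∧ e.1 1 = e'.1 0) := by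
    have a0 : e.1 0 ∈ ({e'.1 0, e'.1 1} : Finset (Fin 4)) := by rw [← h2]; simp
    have a1 : e.1 1 ∈ ({e'.1 0, e'.1 1} : Finset (Fin 4)) := by rw [← h2]; simp
    simp only [Finset.mem_insert, Finset.mem_singleton] at a0 a1
    rcases a0 with a0 | a0 <;> rcases a1 with a1 | a1
    · exact absurd (a0.trans a1.symm) hne
    · exact Or.inl ⟨a0, a1⟩
    · exact Or.inr ⟨a0, a1⟩
    · exact absurd (a0.trans a1.symm) hne
  rcases hcase with ⟨a, b⟩ | ⟨a, b⟩
  · rw [evenOrder_ext a b]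
  · refine absurd ((hm.symm _ _).trans _ _ _ hn) ?_
    simp only [flagEdge, ← a, ← b]
    exact T.edge_not_reversed i _ _ hne

theorem eqvGen_cellStep_of_edgeStep {x y : ι × TetEdge} (h : Relation.EqvGen T.EdgeStep x y) :
    Relation.EqvGen T.CellStep (x.1, x.2.1) (y.1, y.2.1) := by
  induction h with
  | rel x y h => obtain ⟨i, f, s, hs⟩ := h; exact .rel _ _ (.step i f s.1 hs)
  | refl => exact .refl _
  | symm _ _ _ ih => exact ih.symm
  | trans _ _ _ _ _ ih ih' => exact ih.trans _ _ _ ih'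

/-- The edge of the ideal triangulation given by an edge of a tetrahedron. -/
def mkEdge (x : ι × TetEdge) : T.Edge := Quot.mk T.EdgeStep x

open Classical in
theorem edge_prod_eq [Fintype ι] (Z : ι → Fin 3 → ℂ) (E : T.Edge) :
    ∏ i, ∏ k, Z i k ^ T.edgeCount i k E
      = ∏ x : ι × TetEdge with T.mkEdge x = E, Z x.1 (label x.2.1) := by
  rw [Finset.prod_filter, Fintype.prod_prod_type]
  refine Finset.prod_congr rfl fun i _ => ?_
  rw [← Finset.prod_filter, ← Finset.prod_fiberwise _ (fun s : TetEdge => label s.1)]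
  refine Finset.prod_congr rfl fun k _ => ?_
  rw [Finset.prod_congr rfl (g := fun _ => Z i k)
    (fun s hs => by rw [(Finset.mem_filter.1 hs).2]), Finset.prod_const]
  congr 1
  change Nat.card {s : TetEdge // label s.1 = k ∧ T.mkEdge (i, s) = E} = _
  rw [Nat.card_eq_fintype_card, Fintype.card_subtype, Finset.filter_filter]
  simp only [and_comm]

/-- The edge of a flag, without its orientation. -/
def flagTetEdge (q : ι × EvenOrder) : ι × TetEdge :=
  (q.1, ⟨{q.2.1 0, q.2.1 1}, Finset.card_pair (by simp)⟩)

theorem mkEdge_flagTetEdge_iterate (q : ι × EvenOrder) (n : ℕ) :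
    T.mkEdge (flagTetEdge (T.turn^[n] q)) = T.mkEdge (flagTetEdge q) := by
  induction n with
  | zero => rfl
  | succ n ih =>
    rw [← ih, Function.iterate_succ_apply']
    generalize T.turn^[n] q = x
    refine (Quot.sound ?_).symm
    have := EdgeStep.step (T := T) x.1 (x.2.1 2) (flagTetEdge x).2 (by simp [flagTetEdge])
    convert this using 1
    · rfl
    refine Prod.ext rfl (Subtype.ext ?_)
    simp [flagTetEdge, turn, turnFun, Finset.map_insert, swap_two_three_zero, swap_two_three_one]

/-- The gluing equation of an edge: the product of the labels encountered when turning once around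
the edge is one. -/
theorem prod_turn_period [Fintype ι] (Z : ι → Fin 3 → ℂ) (hZ : Z ∈ T.deformationVariety) (q : ι × EvenOrder) :
    ∏ m ∈ Finset.range (Function.minimalPeriod T.turn q),
      Z (T.turn^[m] q).1 (label {(T.turn^[m] q).2.1 0, (T.turn^[m] q).2.1 1}) = 1 := by
  classical
  rw [← hZ.2.2 (T.mkEdge (flagTetEdge q)), edge_prod_eq]
  -- One period of `turn` meets each member of the edge class exactly once: a repetition would give
  -- equal flags before the period ends, and every member is reached because the class is one cycle.
  -- The period is positive since there are finitely many flags.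
  refine Finset.prod_nbij (fun m => flagTetEdge (T.turn^[m] q)) ?_ ?_ ?_ ?_
  · intro m _
    simpa using T.mkEdge_flagTetEdge_iterate q m
  · intro m hm n hn h
    rw [Finset.coe_range, Set.mem_Iio] at hm hn
    simp only [flagTetEdge, Prod.mk.injEq, Subtype.mk.injEq] at h
    exact (Function.iterate_eq_iterate_iff_of_lt_minimalPeriod hm hn).1
      (T.eq_of_iterate_turn_of_edge_eq q h.1 h.2)
  · rintro ⟨i, s⟩ hs
    replace hs : T.mkEdge (i, s) = T.mkEdge (flagTetEdge q) := by simpa using hs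
    have h := T.eqvGen_cellStep_of_edgeStep (Quot.eqvGen_exact hs.symm)
    obtain ⟨q', hq', h1, h2⟩ := T.exists_sameCycle_of_eqvGen_cellStep h q rfl rfl
    obtain ⟨n, hn⟩ := hq'.exists_nat_pow_eq
    have hpos : 0 < Function.minimalPeriod T.turn q :=
      Function.minimalPeriod_pos_iff_mem_periodicPts.2
        (Function.Injective.mem_periodicPts T.turn.injective q)
    refine ⟨n % Function.minimalPeriod T.turn q, ?_, ?_⟩
    · simpa using Nat.mod_lt _ hpos
    · dsimp only
      rw [Function.iterate_mod_minimalPeriod_eq, ← Equiv.Perm.coe_pow, hn]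
      exact Prod.ext h1 (Subtype.ext h2)
  · intro m _
    rfl

theorem prod_turn_of_iterate_eq [Fintype ι] (Z : ι → Fin 3 → ℂ) (hZ : Z ∈ T.deformationVariety)
    (q : ι × EvenOrder) (n : ℕ) (hn : T.turn^[n] q = q) :
    ∏ m ∈ Finset.range n,
      Z (T.turn^[m] q).1 (label {(T.turn^[m] q).2.1 0, (T.turn^[m] q).2.1 1}) = 1 := by
  obtain ⟨c, rfl⟩ := Function.IsPeriodicPt.minimalPeriod_dvd (f := T.turn) (x := q) (n := n) hn
  clear hn
  induction c with
  | zero => simp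
  | succ c ih =>
    rw [Nat.mul_succ, Finset.prod_range_add, ih, one_mul]
    rw [← T.prod_turn_period Z hZ q]
    refine Finset.prod_congr rfl fun m _ => ?_
    have : T.turn^[Function.minimalPeriod T.turn q * c + m] q = T.turn^[m] q := by
      rw [← Function.iterate_mod_minimalPeriod_eq (n := _ + m), Nat.mul_add_mod,
        Function.iterate_mod_minimalPeriod_eq]
    rw [this]

end IdealTriangulation

/-! ## The developed triangulation -/

/-- The normalizing isometry fixes 0 and ∞, so it is a homothety `x ↦ a * x` with `a * c = 1`. Hence
the fourth vertex is `c` times the standard one: this is where a shape parameter becomes a holonomy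
factor. -/
theorem HasShape.vertex_three {v : Fin 4 → Ideal3} {z : Fin 3 → ℂ} (h : HasShape v z)
    (e : EvenOrder) {c : ℂ} (h0 : v (e.1 0) = finitePt 0) (h1 : v (e.1 1) = inftyPt)
    (h2 : v (e.1 2) = finitePt c) : v (e.1 3) = finitePt (c * z (label {e.1 0, e.1 1})) := by
  obtain ⟨g, hg⟩ := h e.1 e.2
  have g0 := hg 0
  have g1 := hg 1
  have g2 := hg 2
  have g3 := hg 3
  rw [h0] at g0
  rw [h1] at g1
  rw [h2] at g2
  obtain ⟨a, ha, hga⟩ := smul_finitePt_of_fixes g0 g1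
  rw [hga] at g2
  have hac : a * c = 1 := finitePt_injective g2
  rw [← inv_smul_smul g (v (e.1 3)), g3, inv_smul_eq_iff, hga, ← mul_assoc, hac, one_mul]
  rfl

/-- Pairs of a tetrahedron `i` and an ideal hyperbolic tetrahedron of shape `Z i`. -/
abbrev Developed {ι : Type*} (Z : ι → Fin 3 → ℂ) : Type _ :=
  {x : ι × (Fin 4 → Ideal3) // HasShape x.2 (Z x.1)}

namespace Developed

variable {ι : Type*} {Z : ι → Fin 3 → ℂ}

noncomputable instance : MulAction PSL2C (Developed Z) where
  smul g x := ⟨(x.1.1, g • x.1.2), x.2.smul g⟩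
  one_smul x := Subtype.ext (Prod.ext rfl (one_smul _ x.1.2))
  mul_smul g h x := Subtype.ext (Prod.ext rfl (mul_smul g h x.1.2))

theorem smul_fst (g : PSL2C) (x : Developed Z) : (g • x).1.1 = x.1.1 := rfl

theorem smul_snd (g : PSL2C) (x : Developed Z) : (g • x).1.2 = g • x.1.2 := rfl

theorem exists_smul_eq {x y : Developed Z} (h : x.1.1 = y.1.1) : ∃ g : PSL2C, y = g • x := by
  obtain ⟨⟨i, v⟩, hv⟩ := x
  obtain ⟨⟨j, w⟩, hw⟩ := y
  dsimp only at h
  subst h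
  obtain ⟨g, hg⟩ := hv.exists_smul_eq hw
  exact ⟨g, Subtype.ext (Prod.ext rfl hg)⟩

theorem ext_face (hz : ∀ i, IsShape (Z i)) {x y : Developed Z} (h : x.1.1 = y.1.1) (f : Fin 4)
    (H : ∀ k, k ≠ f → x.1.2 k = y.1.2 k) : x = y := by
  obtain ⟨⟨i, v⟩, hv⟩ := x
  obtain ⟨⟨j, w⟩, hw⟩ := y
  dsimp only at h
  subst h
  exact Subtype.ext (Prod.ext rfl (HasShape.eq_of_face (hz _) hv hw f H))

theorem smul_left_cancel (hz : ∀ i, IsShape (Z i)) {x : Developed Z} {g h : PSL2C}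
    (H : g • x = h • x) : g = h :=
  psl_eq_of_smul_vertices_eq (x.2.injective (hz _)) (congrArg (fun y => y.1.2) H)

end Developed

namespace IdealTriangulation

variable {ι : Type*} (T : IdealTriangulation ι) {Z : ι → Fin 3 → ℂ} (hz : ∀ i, IsShape (Z i))

theorem exists_developed_adj (hz : ∀ i, IsShape (Z i)) (x : Developed Z) (f : Fin 4) :
    ∃ y : Developed Z, y.1.1 = T.adj x.1.1 f ∧
      ∀ k, k ≠ f → y.1.2 (T.glue x.1.1 f k) = x.1.2 k := by
  obtain ⟨w, hw, h⟩ := exists_hasShape_of_face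
    ((x.2.injective (hz _)).comp (T.glue x.1.1 f).symm.injective) (hz (T.adj x.1.1 f))
    (T.glue x.1.1 f f)
  refine ⟨⟨(T.adj x.1.1 f, w), hw⟩, rfl, fun k hk => ?_⟩
  exact (h _ ((T.glue x.1.1 f).injective.ne hk)).trans (by simp)

/-- The tetrahedron that shares the face `f` with a developed tetrahedron. -/
noncomputable def developedAdj (x : Developed Z) (f : Fin 4) : Developed Z :=
  (T.exists_developed_adj hz x f).choose

theorem developedAdj_fst (x : Developed Z) (f : Fin 4) :
    (T.developedAdj hz x f).1.1 = T.adj x.1.1 f :=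
  (T.exists_developed_adj hz x f).choose_spec.1

theorem developedAdj_snd (x : Developed Z) (f k : Fin 4) (hk : k ≠ f) :
    (T.developedAdj hz x f).1.2 (T.glue x.1.1 f k) = x.1.2 k :=
  (T.exists_developed_adj hz x f).choose_spec.2 k hk

/-- The neighbour across a face is determined by the face and the shape. The equivariance of
`developedAdj` and the inverse face pairings of `developed` follow from this. -/
theorem eq_developedAdj {x y : Developed Z} (f : Fin 4) (h : y.1.1 = T.adj x.1.1 f)
    (H : ∀ k, k ≠ f → y.1.2 (T.glue x.1.1 f k) = x.1.2 k) : y = T.developedAdj hz x f := by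
  refine Developed.ext_face hz (h.trans (T.developedAdj_fst hz x f).symm) (T.glue x.1.1 f f)
    fun k hk => ?_
  obtain ⟨k, rfl⟩ := (T.glue x.1.1 f).surjective k
  have hk' : k ≠ f := fun h => hk (by rw [h])
  rw [H k hk', T.developedAdj_snd hz x f k hk']

theorem developedAdj_smul (g : PSL2C) (x : Developed Z) (f : Fin 4) :
    T.developedAdj hz (g • x) f = g • T.developedAdj hz x f := by
  refine (T.eq_developedAdj hz f ?_ fun k hk => ?_).symm
  · rw [Developed.smul_fst, Developed.smul_fst, developedAdj_fst]
  · rw [Developed.smul_snd, Developed.smul_snd, Developed.smul_fst, Pi.smul_apply, Pi.smul_apply,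
      T.developedAdj_snd hz x f k hk]

/-- The projection of developed edges. -/
def projEdge (x : Developed Z × Fin 4 × Fin 4) : ι × Fin 4 × Fin 4 := (x.1.1.1, x.2)

theorem eqvGen_projEdge {x y : Developed Z × Fin 4 × Fin 4}
    (h : Relation.EqvGen (OrientedEdgeStep (T.developedAdj hz) fun x f => T.glue x.1.1 f) x y) :
    Relation.EqvGen (OrientedEdgeStep T.adj T.glue) (projEdge x) (projEdge y) := by
  induction h with
  | rel x y h =>
    obtain ⟨x, f, a, b, ha, hb⟩ := h
    simp only [projEdge, T.developedAdj_fst hz]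
    exact .rel _ _ (.step _ _ _ _ ha hb)
  | refl => exact .refl _
  | symm _ _ _ ih => exact ih.symm
  | trans _ _ _ _ _ ih ih' => exact ih.trans _ _ _ ih'

/-- The ideal triangulation formed by the developed tetrahedra. -/
noncomputable def developed : IdealTriangulation (Developed Z) where
  adj := T.developedAdj hz
  glue x f := T.glue x.1.1 f
  adj_adj x f := by
    refine (T.eq_developedAdj hz _ ?_ fun k hk => ?_).symm
    · rw [developedAdj_fst, T.adj_adj]
    · rw [developedAdj_fst]
      obtain ⟨k, rfl⟩ := (T.glue x.1.1 f).surjective k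
      rw [T.glue_glue_apply, T.developedAdj_snd hz x f k fun h => hk (by rw [h])]
  glue_glue x f := by rw [developedAdj_fst, T.glue_glue]
  pairing_ne x f h := T.pairing_ne x.1.1 f ⟨by rw [← T.developedAdj_fst hz, h.1], h.2⟩
  glue_odd x f := T.glue_odd _ _
  edge_not_reversed x a b hab h := T.edge_not_reversed x.1.1 a b hab (T.eqvGen_projEdge hz h)

theorem developed_adj (x : Developed Z) (f : Fin 4) :
    (T.developed hz).adj x f = T.developedAdj hz x f := rfl

theorem developed_glue (x : Developed Z) (f : Fin 4) :
    (T.developed hz).glue x f = T.glue x.1.1 f := rfl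

/-- The identification of oriented edges in the developed triangulation. -/
abbrev DevelopedEdgeRel : Developed Z × Fin 4 × Fin 4 → Developed Z × Fin 4 × Fin 4 → Prop :=
  Relation.EqvGen (OrientedEdgeStep (T.developed hz).adj (T.developed hz).glue)

theorem developedEdgeRel_smul (g : PSL2C) {x y : Developed Z × Fin 4 × Fin 4}
    (h : T.DevelopedEdgeRel hz x y) : T.DevelopedEdgeRel hz (g • x.1, x.2) (g • y.1, y.2) := by
  induction h with
  | rel x y h =>
    obtain ⟨x, f, a, b, ha, hb⟩ := h
    refine .rel _ _ ?_
    dsimp only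
    rw [developed_adj, ← developedAdj_smul]
    exact .step (adj := (T.developed hz).adj) (glue := (T.developed hz).glue) (g • x) f a b ha hb
  | refl => exact .refl _
  | symm _ _ _ ih => exact ih.symm
  | trans _ _ _ _ _ ih ih' => exact ih.trans _ _ _ ih'

theorem vertex_eq_of_developedEdgeRel {x y : Developed Z × Fin 4 × Fin 4}
    (h : T.DevelopedEdgeRel hz x y) : x.1.1.2 x.2.1 = y.1.1.2 y.2.1 := by
  induction h with
  | rel x y h =>
    obtain ⟨x, f, a, b, ha, hb⟩ := h
    exact (T.developedAdj_snd hz x f a ha).symm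
  | refl => rfl
  | symm _ _ _ ih => exact ih.symm
  | trans _ _ _ _ _ ih ih' => exact ih.trans ih'

/-- The projection of flags. -/
def projFlag (q : Developed Z × EvenOrder) : ι × EvenOrder := (q.1.1.1, q.2)

theorem projFlag_turn (q : Developed Z × EvenOrder) :
    projFlag ((T.developed hz).turn q) = T.turn (projFlag q) :=
  Prod.ext (T.developedAdj_fst hz _ _) rfl

theorem projFlag_iterate (q : Developed Z × EvenOrder) (n : ℕ) :
    projFlag ((T.developed hz).turn^[n] q) = T.turn^[n] (projFlag q) :=
  (Function.Semiconj.iterate_right (f := projFlag) (fun q => T.projFlag_turn hz q) n) q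

/-- The edge stays at 0, ∞. After a turn, the old fourth vertex is the new third one, so the third
vertex accumulates the labels passed. -/
theorem iterate_turn_vertices (q : Developed Z × EvenOrder) {c : ℂ}
    (h0 : q.1.1.2 (q.2.1 0) = finitePt 0) (h1 : q.1.1.2 (q.2.1 1) = inftyPt)
    (h2 : q.1.1.2 (q.2.1 2) = finitePt c) (n : ℕ) (q' : Developed Z × EvenOrder)
    (hq' : (T.developed hz).turn^[n] q = q') :
    q'.1.1.2 (q'.2.1 0) = finitePt 0 ∧ q'.1.1.2 (q'.2.1 1) = inftyPt ∧
    q'.1.1.2 (q'.2.1 2) = finitePt (c * ∏ m ∈ Finset.range n,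
      Z (T.turn^[m] (projFlag q)).1
        (label {(T.turn^[m] (projFlag q)).2.1 0, (T.turn^[m] (projFlag q)).2.1 1})) := by
  induction n generalizing q' with
  | zero => subst hq'; simpa using ⟨h0, h1, h2⟩
  | succ n ih =>
    rw [Function.iterate_succ_apply'] at hq'
    obtain ⟨i0, i1, i2⟩ := ih _ rfl
    have hp := T.projFlag_iterate hz q n
    rw [Finset.prod_range_succ, ← hp, ← mul_assoc]
    generalize (T.developed hz).turn^[n] q = r at *
    subst hq'
    have step : ∀ k, k ≠ r.2.1 2 → ((T.developed hz).turn r).1.1.2 (T.glue r.1.1.1 (r.2.1 2) k)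
        = r.1.1.2 k := fun k hk => T.developedAdj_snd hz r.1 (r.2.1 2) k hk
    refine ⟨?_, ?_, ?_⟩
    · rw [← i0, ← step _ (by simp)]
      simp [turn, turnFun, developed_glue, swap_two_three_zero]
    · rw [← i1, ← step _ (by simp)]
      simp [turn, turnFun, developed_glue, swap_two_three_one]
    · have h3 : ((T.developed hz).turn r).2.1 2 = T.glue r.1.1.1 (r.2.1 2) (r.2.1 3) := by
        simp [turn, turnFun, developed_glue]
      rw [h3, step _ (by simp), r.1.2.vertex_three r.2 i0 i1 i2]
      rfl

/-- Turning around an edge of the developed triangulation and coming back to a tetrahedron with the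
same projection, one comes back to the same tetrahedron. -/
theorem eq_of_iterate_turn_developed [Fintype ι] (hZ : Z ∈ T.deformationVariety)
    {q q' : Developed Z × EvenOrder} (n : ℕ) (h : (T.developed hz).turn^[n] q = q')
    (hq : projFlag q = projFlag q') : q = q' := by
  have smul_turn : ∀ (g : PSL2C) (q : Developed Z × EvenOrder),
      (T.developed hz).turn (g • q.1, q.2) =
        (g • ((T.developed hz).turn q).1, ((T.developed hz).turn q).2) := fun g q =>
    Prod.ext (T.developedAdj_smul hz g q.1 _) rfl
  obtain ⟨x, e⟩ := q
  obtain ⟨x', e'⟩ := q'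
  simp only [projFlag, Prod.mk.injEq] at hq
  obtain ⟨hx, rfl⟩ := hq
  have hv := x.2.injective (hz _)
  -- By equivariance the first three vertices may be taken to be 0, ∞, 1. The accumulated product is
  -- then one, so start and end share this face and the shape.
  obtain ⟨g, g0, g1, g2⟩ := exists_psl_std (p := x.1.2 (e.1 0)) (q := x.1.2 (e.1 1))
    (r := x.1.2 (e.1 2)) (hv.ne (by simp)) (hv.ne (by simp)) (hv.ne (by simp))
  have key : ∀ m, (T.developed hz).turn^[m] (g • x, e) =
      (g • ((T.developed hz).turn^[m] (x, e)).1, ((T.developed hz).turn^[m] (x, e)).2) := by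
    intro m
    induction m with
    | zero => rfl
    | succ m ih => rw [Function.iterate_succ_apply', Function.iterate_succ_apply', ih, smul_turn]
  have hn : (T.developed hz).turn^[n] (g • x, e) = (g • x', e) := by rw [key, h]
  obtain ⟨i0, i1, i2⟩ := T.iterate_turn_vertices hz (g • x, e) g0 g1 g2 n _ hn
  have hper : T.turn^[n] (projFlag (g • x, e)) = projFlag (g • x, e) := by
    rw [← T.projFlag_iterate hz, hn]
    simp only [projFlag, Developed.smul_fst, hx]
  rw [T.prod_turn_of_iterate_eq Z hZ _ n hper, mul_one] at i2
  have : g • x = g • x' := by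
    refine Developed.ext_face hz hx (e.1 3) fun k hk => ?_
    obtain ⟨k, rfl⟩ := e.1.surjective k
    fin_cases k
    · exact g0.trans i0.symm
    · exact g1.trans i1.symm
    · exact g2.trans i2.symm
    · exact absurd rfl hk
  rw [MulAction.injective g this]

/-- The edges of the developed triangulation have trivial holonomy. -/
theorem eq_of_developedEdgeRel [Fintype ι] (hZ : Z ∈ T.deformationVariety)
    {x y : Developed Z} {a b : Fin 4} (hab : a ≠ b)
    (h : T.DevelopedEdgeRel hz (x, a, b) (y, a, b)) (hxy : x.1.1 = y.1.1) : x = y := by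
  obtain ⟨e, rfl, rfl⟩ := exists_evenOrder hab
  obtain ⟨q', hq', hqe⟩ := (T.developed hz).exists_sameCycle_of_eqvGen_orientedEdgeStep h (x, e) rfl
  have : q' = (y, e) := flagEdge_injective hqe
  subst this
  obtain ⟨m, hm⟩ := hq'
  have hp : projFlag (x, e) = projFlag (y, e) := Prod.ext hxy rfl
  obtain ⟨n, rfl | rfl⟩ := m.eq_nat_or_neg
  · rw [zpow_natCast, Equiv.Perm.coe_pow] at hm
    exact congrArg Prod.fst (T.eq_of_iterate_turn_developed hz hZ n hm hp)
  · rw [zpow_neg, zpow_natCast, Equiv.Perm.inv_eq_iff_eq, Equiv.Perm.coe_pow] at hm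
    exact (congrArg Prod.fst (T.eq_of_iterate_turn_developed hz hZ n hm.symm hp.symm)).symm

/-- `PSL₂(ℂ)` acts freely on the edges of the developed triangulation. -/
theorem eq_of_developedEdgeRel_smul [Fintype ι] (hZ : Z ∈ T.deformationVariety)
    {x : Developed Z} {a b : Fin 4} (hab : a ≠ b) {g h : PSL2C}
    (H : T.DevelopedEdgeRel hz (g • x, a, b) (h • x, a, b)) : g = h :=
  Developed.smul_left_cancel hz (T.eq_of_developedEdgeRel hz hZ hab H rfl)

end IdealTriangulation

/-! ## The topology of an ideally triangulated space -/

theorem IdealSimplex.permute_permute (g h : Equiv.Perm (Fin 4)) (t : IdealSimplex) :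
    (t.permute g).permute h = t.permute (h * g) := rfl

theorem IdealSimplex.permute_one (t : IdealSimplex) : t.permute 1 = t := rfl

theorem IdealSimplex.permute_apply (g : Equiv.Perm (Fin 4)) (t : IdealSimplex) (k : Fin 4) :
    (t.permute g).1 (g k) = t.1 k := by
  simp [IdealSimplex.permute]

/-- Vertices are removed, so every point is interior to an edge, a triangle or a tetrahedron. These
are the cells on which the action is shown to be free. -/
theorem IdealSimplex.two_le_card_support (t : IdealSimplex) :
    2 ≤ (Finset.univ.filter fun k => 0 < t.1 k).card := by
  by_contra! h
  have hsum := t.2.1.2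
  rw [← Finset.sum_filter_add_sum_filter_not _ (fun k => 0 < t.1 k)] at hsum
  have h0 : ∑ k with ¬ 0 < t.1 k, t.1 k = 0 := by
    refine Finset.sum_eq_zero fun k hk => ?_
    exact le_antisymm (not_lt.1 (Finset.mem_filter.1 hk).2) (t.2.1.1 k)
  rw [h0, add_zero] at hsum
  interval_cases hc : (Finset.univ.filter fun k => 0 < t.1 k).card
  · rw [Finset.card_eq_zero.1 hc] at hsum
    simp at hsum
  · obtain ⟨k, hk⟩ := Finset.card_eq_one.1 hc
    rw [hk, Finset.sum_singleton] at hsum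
    exact t.2.2 k hsum

namespace IdealTriangulation

/-! ### Cells, open stars and the quotient topology. -/

section General

variable {ι : Type*} (T : IdealTriangulation ι)

theorem isOpen_space_iff {U : Set T.Space} : IsOpen U ↔ ∀ i, IsOpen (T.char i ⁻¹' U) := by
  have h : IsOpen U ↔ IsOpen ((Quot.mk T.FacePairing) ⁻¹' U) := Iff.rfl
  rw [h, isOpen_sigma_iff]
  rfl

theorem continuous_char (i : ι) : Continuous (T.char i) :=
  continuous_def.2 fun _ hU => T.isOpen_space_iff.1 hU i

theorem continuous_space_iff {X : Type*} [TopologicalSpace X] {F : T.Space → X} :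
    Continuous F ↔ ∀ i, Continuous (F ∘ T.char i) := by
  refine ⟨fun h i => h.comp (T.continuous_char i), fun h => continuous_def.2 fun U hU => ?_⟩
  exact T.isOpen_space_iff.2 fun i => (h i).isOpen_preimage U hU

theorem exists_eq_char (x : T.Space) : ∃ i t, x = T.char i t := by
  induction x using Quot.ind with
  | mk a => exact ⟨a.1, a.2, rfl⟩

theorem char_adj (i : ι) (f : Fin 4) (t : IdealSimplex) (ht : t.1 f = 0) :
    T.char (T.adj i f) (t.permute (T.glue i f)) = T.char i t :=
  (Quot.sound (FacePairing.pair i f t ht)).symm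

instance : Std.Symm T.FacePairing where
  symm := by
    rintro _ _ ⟨i, f, t, ht⟩
    have := FacePairing.pair (T := T) (T.adj i f) (T.glue i f f) (t.permute (T.glue i f))
      (by rw [IdealSimplex.permute_apply, ht])
    rwa [T.adj_adj, T.glue_glue, IdealSimplex.permute_permute, inv_mul_cancel,
      IdealSimplex.permute_one] at this

/-- The condition that a point of a tetrahedron lies in the star of a face, that is, that the
coordinates of the point at the vertices of the face are larger than the others. -/
def InStar (c : ι × Finset (Fin 4)) (a : Σ _ : ι, IdealSimplex) : Prop :=
  ∃ s : Finset (Fin 4), Relation.EqvGen T.CellStep (a.1, s) c ∧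
    (∀ k ∈ s, 0 < a.2.1 k) ∧ ∀ k ∈ s, ∀ l ∉ s, a.2.1 l < a.2.1 k

theorem InStar.of_facePairing {c : ι × Finset (Fin 4)} {a b : Σ _ : ι, IdealSimplex}
    (h : T.FacePairing a b) (ha : T.InStar c a) : T.InStar c b := by
  obtain ⟨i, f, t, ht⟩ := h
  obtain ⟨s, hs, hpos, hlt⟩ := ha
  have hf : f ∉ s := fun hf => (hpos f hf).ne' ht
  refine ⟨s.map (T.glue i f).toEmbedding,
    (Relation.EqvGen.rel _ _ (CellStep.step i f s hf)).symm.trans _ _ _ hs, ?_, ?_⟩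
  · intro k hk
    obtain ⟨k, hk', rfl⟩ := Finset.mem_map.1 hk
    rw [Equiv.coe_toEmbedding, IdealSimplex.permute_apply]
    exact hpos k hk'
  · intro k hk l hl
    obtain ⟨k, hk', rfl⟩ := Finset.mem_map.1 hk
    obtain ⟨l, rfl⟩ := (T.glue i f).surjective l
    rw [Equiv.coe_toEmbedding, IdealSimplex.permute_apply, IdealSimplex.permute_apply]
    exact hlt k hk' l (by simpa using hl)

/-- The star of a face of a tetrahedron in the barycentric subdivision. -/
def star (c : ι × Finset (Fin 4)) : Set T.Space :=
  Quot.lift (T.InStar c) fun _ _ h => propext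
    ⟨InStar.of_facePairing T h, InStar.of_facePairing T (symm h)⟩

theorem char_mem_star {c : ι × Finset (Fin 4)} {i : ι} {t : IdealSimplex} :
    T.char i t ∈ T.star c ↔ T.InStar c ⟨i, t⟩ := Iff.rfl

theorem isOpen_star (c : ι × Finset (Fin 4)) : IsOpen (T.star c) := by
  refine T.isOpen_space_iff.2 fun i => ?_
  have hcont : ∀ k, Continuous fun t : IdealSimplex => t.1 k := fun k =>
    (continuous_apply k).comp continuous_subtype_val
  have : T.char i ⁻¹' T.star c = ⋃ (s : Finset (Fin 4))
      (_ : Relation.EqvGen T.CellStep (i, s) c), {t | (∀ k ∈ s, 0 < t.1 k)} ∩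
        {t | ∀ k ∈ s, ∀ l ∉ s, t.1 l < t.1 k} := by
    ext t
    simp only [Set.mem_preimage, char_mem_star, InStar, Set.mem_iUnion, Set.mem_inter_iff,
      Set.mem_ofPred_eq, exists_prop]
  rw [this]
  refine isOpen_iUnion fun s => isOpen_iUnion fun _ => IsOpen.inter ?_ ?_
  · simp only [Set.ofPred_forall]
    exact isOpen_iInter_of_finite fun k => isOpen_iInter_of_finite fun _ =>
      isOpen_lt continuous_const (hcont k)
  · simp only [Set.ofPred_forall]
    exact isOpen_iInter_of_finite fun k => isOpen_iInter_of_finite fun _ =>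
      isOpen_iInter_of_finite fun l => isOpen_iInter_of_finite fun _ =>
        isOpen_lt (hcont l) (hcont k)

theorem char_mem_star_support (i : ι) (t : IdealSimplex) :
    T.char i t ∈ T.star (i, Finset.univ.filter fun k => 0 < t.1 k) := by
  refine T.char_mem_star.2 ⟨_, .refl _, by simp, ?_⟩
  intro k hk l hl
  have hk' : 0 < t.1 k := by simpa using hk
  have hl' : t.1 l ≤ 0 := by simpa using hl
  exact hl'.trans_lt hk'

theorem eqvGen_of_sameCycle {q q' : ι × EvenOrder} (h : T.turn.SameCycle q q') :
    Relation.EqvGen (OrientedEdgeStep T.adj T.glue) (flagEdge q) (flagEdge q') := by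
  obtain ⟨m, hm⟩ := h
  obtain ⟨n, rfl | rfl⟩ := m.eq_nat_or_neg
  · rw [zpow_natCast, Equiv.Perm.coe_pow] at hm
    subst hm
    exact T.eqvGen_flagEdge_turn_pow q n
  · rw [zpow_neg, zpow_natCast, Equiv.Perm.inv_eq_iff_eq, Equiv.Perm.coe_pow] at hm
    subst hm
    exact (T.eqvGen_flagEdge_turn_pow q' n).symm

/-- The orbits of faces of dimension two. -/
theorem eqvGen_cellStep_face {x y : ι × Finset (Fin 4)} (h : Relation.EqvGen T.CellStep x y)
    (f : Fin 4) (hf : ∀ k, k ∈ x.2 ↔ k ≠ f) :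
    y = x ∨ y.1 = T.adj x.1 f ∧ y.2 = x.2.map (T.glue x.1 f).toEmbedding := by
  rw [Relation.EqvGen.eqvGen_eq_reflTransGen] at h
  induction h with
  | refl => exact Or.inl rfl
  | @tail y w _ h ih =>
    rcases ih with rfl | ⟨h1, h2⟩
    · obtain ⟨i, f', s, hs⟩ := h
      have : f' = f := by
        by_contra hne
        exact hs ((hf f').2 hne)
      subst this
      exact Or.inr ⟨rfl, rfl⟩
    · obtain ⟨i, f', s, hs⟩ := h
      dsimp only at h1 h2
      subst h1 h2
      have : f' = T.glue x.1 f f := by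
        by_contra hne
        obtain ⟨k, rfl⟩ := (T.glue x.1 f).surjective f'
        refine hs (Finset.mem_map_of_mem _ ((hf k).2 ?_))
        rintro rfl
        exact hne rfl
      subst this
      left
      refine Prod.ext (T.adj_adj _ _) ?_
      ext k
      simp [T.glue_glue, Equiv.Perm.inv_def]

end General

/-! ### The developed space as a covering with group `PSL2C`. -/

section Developed

variable {ι : Type*} (T : IdealTriangulation ι) {Z : ι → Fin 3 → ℂ} (hz : ∀ i, IsShape (Z i))

/-- No cell of positive dimension is identified with a nontrivial translate of itself. For edges, a
reversal is excluded downstairs and the remaining case is the gluing equation. A triangle lies in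
two tetrahedra only, so a nontrivial translate would project to a face paired with itself. A full
tetrahedron admits no identification at all. -/
theorem eqvGen_cellStep_developed_eq_one [Fintype ι] (hZ : Z ∈ T.deformationVariety)
    (x : Developed Z) (s : Finset (Fin 4)) (hs : 2 ≤ s.card) (g : PSL2C)
    (h : Relation.EqvGen (T.developed hz).CellStep (x, s) (g • x, s)) : g = 1 := by
  have of_eq : g • x = x → g = 1 := fun h =>
    Developed.smul_left_cancel hz (h.trans (one_smul _ x).symm)
  have hs4 : s.card ≤ 4 := by simpa using Finset.card_le_univ s
  interval_cases hc : s.card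
  · obtain ⟨a, b, hab, rfl⟩ := Finset.card_eq_two.1 hc
    obtain ⟨e, rfl, rfl⟩ := exists_evenOrder hab
    obtain ⟨⟨y, e'⟩, hq, h1, h2⟩ :=
      (T.developed hz).exists_sameCycle_of_eqvGen_cellStep h (x, e) rfl rfl
    have hE := (T.developed hz).eqvGen_of_sameCycle hq
    dsimp only at h1 h2
    subst h1
    have a0 : e'.1 0 ∈ ({e.1 0, e.1 1} : Finset (Fin 4)) := by rw [← h2]; simp
    have a1 : e'.1 1 ∈ ({e.1 0, e.1 1} : Finset (Fin 4)) := by rw [← h2]; simp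
    simp only [Finset.mem_insert, Finset.mem_singleton] at a0 a1
    have hne : e'.1 0 ≠ e'.1 1 := by simp
    rcases a0 with a0 | a0 <;> rcases a1 with a1 | a1
    · exact absurd (a0.trans a1.symm) hne
    · simp only [flagEdge, a0, a1] at hE
      exact of_eq (T.eq_of_developedEdgeRel hz hZ hab hE rfl).symm
    · simp only [flagEdge, a0, a1] at hE
      exact absurd (T.eqvGen_projEdge hz hE) (T.edge_not_reversed _ _ _ hab)
    · exact absurd (a0.trans a1.symm) hne
  · obtain ⟨f, hf⟩ : ∃ f, sᶜ = {f} := Finset.card_eq_one.1 (by rw [Finset.card_compl, hc]; rfl)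
    have hf' : ∀ k, k ∈ s ↔ k ≠ f := fun k => by
      have := Finset.ext_iff.1 hf k
      simp only [Finset.mem_compl, Finset.mem_singleton] at this
      rw [ne_eq, ← this, not_not]
    rcases (T.developed hz).eqvGen_cellStep_face h f hf' with h1 | ⟨h1, h2⟩
    · exact of_eq (congrArg Prod.fst h1)
    · exfalso
      refine T.pairing_ne x.1.1 f ⟨?_, ?_⟩
      · rw [← T.developedAdj_fst hz]
        exact congrArg (fun y => y.1.1) h1.symm
      · by_contra hne
        have : T.glue x.1.1 f f ∈ s.map (T.glue x.1.1 f).toEmbedding := by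
          rw [developed_glue] at h2
          dsimp only at h2
          rw [← h2]
          exact (hf' _).2 hne
        simp [hf'] at this
  · have hu : s = Finset.univ := Finset.eq_univ_of_card s (by simpa using hc)
    rw [Relation.EqvGen.eqvGen_eq_reflTransGen] at h
    have : ∀ y, Relation.ReflTransGen (T.developed hz).CellStep (x, s) y → y = (x, s) := by
      intro y hy
      induction hy with
      | refl => rfl
      | tail _ h ih =>
        subst ih
        obtain ⟨_, f, _, hf⟩ := h
        exact absurd (hu ▸ Finset.mem_univ f) hf
    exact of_eq (congrArg Prod.fst (this _ h))

theorem developed_char_smul (g : PSL2C) {x y : Developed Z} {t t' : IdealSimplex}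
    (h : (T.developed hz).FacePairing ⟨x, t⟩ ⟨y, t'⟩) :
    (T.developed hz).FacePairing ⟨g • x, t⟩ ⟨g • y, t'⟩ := by
  obtain ⟨x, f, t, ht⟩ := h
  rw [developed_adj, ← developedAdj_smul]
  exact FacePairing.pair (T := T.developed hz) (g • x) f t ht

noncomputable instance : MulAction PSL2C (T.developed hz).Space where
  smul g := Quot.map (fun a => ⟨g • a.1, a.2⟩) fun _ _ h => T.developed_char_smul hz g h
  one_smul d := by
    induction d using Quot.ind with
    | mk a => exact congrArg (Quot.mk _) (Sigma.ext (one_smul _ a.1) HEq.rfl)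
  mul_smul g h d := by
    induction d using Quot.ind with
    | mk a => exact congrArg (Quot.mk _) (Sigma.ext (mul_smul g h a.1) HEq.rfl)

theorem smul_developed_char (g : PSL2C) (x : Developed Z) (t : IdealSimplex) :
    g • (T.developed hz).char x t = (T.developed hz).char (g • x) t := rfl

/-- The projection of the developed space. -/
def developedProj : (T.developed hz).Space → T.Space :=
  Quot.lift (fun a => T.char a.1.1.1 a.2) (by
    rintro _ _ ⟨x, f, t, ht⟩
    rw [developed_adj, developed_glue]
    dsimp only
    rw [developedAdj_fst, T.char_adj _ _ _ ht])

theorem continuous_developedProj : Continuous (T.developedProj hz) :=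
  (T.developed hz).continuous_space_iff.2 fun x => T.continuous_char x.1.1

/-- The developed tetrahedron in standard position. -/
noncomputable def stdDeveloped (hz : ∀ i, IsShape (Z i)) (i : ι) : Developed Z :=
  ⟨(i, stdVertices (Z i 0)), hasShape_stdVertices (hz i)⟩

theorem isQuotientMap_developedProj : Topology.IsQuotientMap (T.developedProj hz) := by
  refine (Topology.isQuotientMap_iff _).2 ⟨Topology.isCoinducing_iff.2 fun U => ⟨fun h =>
    T.isOpen_space_iff.2 fun i => (T.developed hz).isOpen_space_iff.1 h (stdDeveloped hz i),
    fun h => h.preimage (T.continuous_developedProj hz)⟩, fun x => ?_⟩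
  obtain ⟨i, t, rfl⟩ := T.exists_eq_char x
  exact ⟨(T.developed hz).char (stdDeveloped hz i) t, rfl⟩

/-- Each face pairing of `T` lifts by passing to the developed neighbour. As `PSL2C` is transitive
on the tetrahedra over a given one, the fibres of `developedProj` are orbits. -/
theorem exists_developed_char_eq {a b : Σ _ : ι, IdealSimplex}
    (h : Relation.EqvGen T.FacePairing a b) (x : Developed Z) (hx : x.1.1 = a.1) :
    ∃ y : Developed Z, y.1.1 = b.1 ∧
      (T.developed hz).char x a.2 = (T.developed hz).char y b.2 := by
  rw [Relation.EqvGen.eqvGen_eq_reflTransGen] at h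
  induction h with
  | refl => exact ⟨x, hx, rfl⟩
  | tail _ h ih =>
    obtain ⟨y, hy, he⟩ := ih
    obtain ⟨i, f, t, ht⟩ := h
    dsimp only at hy
    subst hy
    exact ⟨T.developedAdj hz y f, T.developedAdj_fst hz y f,
      he.trans ((T.developed hz).char_adj y f t ht).symm⟩

/-- The developed space is a covering space of the ideally triangulated space, with group
`PSL₂(ℂ)`. -/
theorem isQuotientCoveringMap_developedProj [Fintype ι] (hZ : Z ∈ T.deformationVariety) :
    IsQuotientCoveringMap (T.developedProj hz) PSL2C where
  __ := T.isQuotientMap_developedProj hz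
  continuous_const_smul g := (T.developed hz).continuous_space_iff.2 fun x =>
    (T.developed hz).continuous_char (g • x)
  apply_eq_iff_mem_orbit := by
    intro d d'
    obtain ⟨x, t, rfl⟩ := (T.developed hz).exists_eq_char d
    obtain ⟨x', t', rfl⟩ := (T.developed hz).exists_eq_char d'
    constructor
    · intro h
      obtain ⟨y, hy, he⟩ := T.exists_developed_char_eq hz (Quot.eqvGen_exact h) x rfl
      obtain ⟨g, rfl⟩ := Developed.exists_smul_eq (x := x') (y := y) hy.symm
      exact ⟨g, he.symm⟩
    · rintro ⟨g, hg⟩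
      dsimp only at hg
      rw [← hg]
      rfl
  disjoint d := by
    obtain ⟨x, t, rfl⟩ := (T.developed hz).exists_eq_char d
    refine ⟨_, ((T.developed hz).isOpen_star _).mem_nhds
      ((T.developed hz).char_mem_star_support x t), ?_⟩
    rintro g ⟨_, ⟨d, hd, rfl⟩, hd'⟩
    obtain ⟨y, t', rfl⟩ := (T.developed hz).exists_eq_char d
    obtain ⟨s, hs, -, hlt⟩ := (T.developed hz).char_mem_star.1 hd
    obtain ⟨s', hs', -, hlt'⟩ := (T.developed hz).char_mem_star.1 hd'
    have hcard := card_eq_of_eqvGen_cellStep _ hs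
    have hcard' := card_eq_of_eqvGen_cellStep _ hs'
    dsimp only at hlt hlt' hcard hcard'
    -- Both sets consist of the largest coordinates of the same point `t'`, and both have the
    -- cardinality of the support of `t`.
    have hss : s = s' := by
      by_contra hne
      have h1 : ¬ s ⊆ s' := fun h => hne (Finset.eq_of_subset_of_card_le h (by omega))
      have h2 : ¬ s' ⊆ s := fun h => hne (Finset.eq_of_subset_of_card_le h (by omega)).symm
      obtain ⟨k, hk, hk'⟩ := Finset.not_subset.1 h1
      obtain ⟨l, hl, hl'⟩ := Finset.not_subset.1 h2
      exact lt_asymm (hlt k hk l hl') (hlt' l hl k hk')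
    subst hss
    exact T.eqvGen_cellStep_developed_eq_one hz hZ y s
      (hcard ▸ t.two_le_card_support) g (hs.trans _ _ _ (hs'.symm))

end Developed

end IdealTriangulation

/-! ## Face preserving homeomorphisms of the simplex -/

section Reparam

variable {κ : Type*} [Fintype κ] {c : κ → κ → ℝ}

/-- The homogeneous cubic weights `t k ^ 2 * ∑ l, c k l * t l`. -/
def cubicWeight (c : κ → κ → ℝ) (t : κ → ℝ) (k : κ) : ℝ := t k ^ 2 * ∑ l, c k l * t l

theorem sum_mul_exp_pos [Nontrivial κ] (hd : ∀ k, c k k = 0) (hc : ∀ k l, k ≠ l → 0 < c k l)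
    (y : κ → ℝ) (k : κ) : 0 < ∑ l, c k l * Real.exp (y l) := by
  obtain ⟨l, hl⟩ := exists_ne k
  refine Finset.sum_pos' (fun l _ => ?_) ⟨l, Finset.mem_univ _, ?_⟩
  · by_cases h : k = l
    · subst h; simp [hd]
    · have := hc k l h; positivity
  · have := hc k l hl.symm; positivity

/-- In logarithmic coordinates, the solutions of `cubicWeight c t = w` are the fixed points of this
map, which is a contraction. -/
noncomputable def logStep (c : κ → κ → ℝ) (w : κ → ℝ) (y : κ → ℝ) : κ → ℝ :=
  fun k => (Real.log (w k) - Real.log (∑ l, c k l * Real.exp (y l))) / 2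

/-- The logarithm of a positive combination of exponentials is 1-Lipschitz in the sup metric. The
square in `t k ^ 2` leads to the division by two in `logStep`, which makes the constant `1 / 2`. -/
theorem contractingWith_logStep [Nontrivial κ] (hd : ∀ k, c k k = 0)
    (hc : ∀ k l, k ≠ l → 0 < c k l) (w : κ → ℝ) : ContractingWith (1 / 2) (logStep c w) := by
  refine ⟨by rw [← NNReal.coe_lt_coe]; norm_num, LipschitzWith.of_dist_le_mul fun y y' => ?_⟩
  have key : ∀ (y y' : κ → ℝ) k, Real.log (∑ l, c k l * Real.exp (y l))
      ≤ dist y y' + Real.log (∑ l, c k l * Real.exp (y' l)) := by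
    intro y y' k
    have h := sum_mul_exp_pos hd hc y k
    have h' := sum_mul_exp_pos hd hc y' k
    rw [← Real.log_exp (dist y y'), ← Real.log_mul (Real.exp_pos _).ne' h'.ne']
    refine Real.log_le_log h ?_
    rw [Finset.mul_sum]
    refine Finset.sum_le_sum fun l _ => ?_
    have hcl : 0 ≤ c k l := by
      by_cases hkl : k = l
      · subst hkl; exact (hd k).ge
      · exact (hc k l hkl).le
    have he : Real.exp (y l) ≤ Real.exp (dist y y') * Real.exp (y' l) := by
      rw [← Real.exp_add]
      refine Real.exp_le_exp.2 ?_
      have := dist_le_pi_dist y y' l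
      rw [Real.dist_eq] at this
      linarith [le_abs_self (y l - y' l)]
    calc c k l * Real.exp (y l) ≤ c k l * (Real.exp (dist y y') * Real.exp (y' l)) :=
          mul_le_mul_of_nonneg_left he hcl
      _ = _ := by ring
  rw [dist_pi_le_iff (by positivity)]
  intro k
  have h1 := key y y' k
  have h2 := key y' y k
  rw [dist_comm y' y] at h2
  rw [Real.dist_eq, abs_le]
  simp only [logStep]
  push_cast
  constructor <;> linarith

theorem cubicWeight_eq_iff [Nontrivial κ] (hd : ∀ k, c k k = 0) (hc : ∀ k l, k ≠ l → 0 < c k l)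
    {w : κ → ℝ} (hw : ∀ k, 0 < w k) (y : κ → ℝ) :
    cubicWeight c (fun k => Real.exp (y k)) = w ↔ Function.IsFixedPt (logStep c w) y := by
  rw [Function.IsFixedPt, funext_iff, funext_iff]
  refine forall_congr' fun k => ?_
  have h := sum_mul_exp_pos hd hc y k
  rw [cubicWeight, ← Real.exp_log h, ← Real.exp_nat_mul, ← Real.exp_add, ← Real.log_injOn_pos.eq_iff
    (Real.exp_pos _) (hw k), Real.log_exp, logStep]
  push_cast
  constructor <;> intro h <;> linarith

theorem existsUnique_cubicWeight_of_pos [Nontrivial κ] (hd : ∀ k, c k k = 0)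
    (hc : ∀ k l, k ≠ l → 0 < c k l) {w : κ → ℝ} (hw : ∀ k, 0 < w k) :
    ∃! t : κ → ℝ, (∀ k, 0 < t k) ∧ cubicWeight c t = w := by
  have hcon := contractingWith_logStep hd hc w
  refine ⟨fun k => Real.exp (ContractingWith.fixedPoint _ hcon k), ⟨fun k => Real.exp_pos _,
    (cubicWeight_eq_iff hd hc hw _).2 hcon.fixedPoint_isFixedPt⟩, ?_⟩
  rintro t ⟨ht, h⟩
  have hexp : (fun k => Real.exp (Real.log (t k))) = t := funext fun k => Real.exp_log (ht k)
  have := hcon.fixedPoint_unique ((cubicWeight_eq_iff hd hc hw fun k => Real.log (t k)).1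
    (by rw [hexp, h]))
  rw [← this, hexp]

/-- Coordinates where `w` vanishes are prescribed to be zero, so the equation restricts to the
support of `w`, where all weights are positive. Two support elements are needed because `c` vanishes
on the diagonal. -/
theorem existsUnique_cubicWeight (hd : ∀ k, c k k = 0) (hc : ∀ k l, k ≠ l → 0 < c k l)
    {w : κ → ℝ} (hw : ∀ k, 0 ≤ w k) (hw2 : {k | w k ≠ 0}.Nontrivial) :
    ∃! t : κ → ℝ, (∀ k, 0 ≤ t k) ∧ (∀ k, t k = 0 ↔ w k = 0) ∧ cubicWeight c t = w := by
  classical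
  let S := {k // w k ≠ 0}
  have : Nontrivial S := by
    obtain ⟨a, ha, b, hb, hab⟩ := hw2
    exact ⟨⟨a, ha⟩, ⟨b, hb⟩, fun h => hab (congrArg Subtype.val h)⟩
  have restrict : ∀ (t : κ → ℝ), (∀ k, t k = 0 ↔ w k = 0) → ∀ k : S,
      cubicWeight c t k = cubicWeight (fun a b : S => c a b) (fun a : S => t a) k := by
    intro t ht k
    simp only [cubicWeight]
    congr 1
    rw [← Finset.sum_subtype (Finset.univ.filter fun k => w k ≠ 0) (by simp)
      fun l => c k l * t l, Finset.sum_filter]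
    refine Finset.sum_congr rfl fun l _ => ?_
    split_ifs with h
    · rfl
    · rw [(ht l).2 (not_not.1 h), mul_zero]
  have hcS : ∀ a b : S, a ≠ b → 0 < c a b := fun a b hab => hc a b (Subtype.coe_injective.ne hab)
  obtain ⟨s, ⟨hs, hsw⟩, huniq⟩ := existsUnique_cubicWeight_of_pos (c := fun a b : S => c a b)
    (fun a => hd a) hcS (w := fun a : S => w a) (fun a => (hw a).lt_of_ne a.2.symm)
  let t : κ → ℝ := fun k => if h : w k ≠ 0 then s ⟨k, h⟩ else 0
  have htS : (fun a : S => t a) = s := funext fun a => dif_pos a.2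
  have ht0 : ∀ k, t k = 0 ↔ w k = 0 := fun k => by
    by_cases h : w k = 0
    · simp [t, h]
    · simp [t, h, (hs ⟨k, h⟩).ne']
  refine ⟨t, ⟨fun k => ?_, ht0, funext fun k => ?_⟩, ?_⟩
  · by_cases h : w k = 0
    · simp [t, h]
    · simp [t, h, (hs ⟨k, h⟩).le]
  · by_cases h : w k = 0
    · simp [cubicWeight, (ht0 k).2 h, h]
    · rw [restrict t ht0 ⟨k, h⟩, htS, hsw]
  · rintro t' ⟨h1, h2, h3⟩
    have : (fun a : S => t' a) = s := by
      refine huniq _ ⟨fun a => (h1 a).lt_of_ne fun h => a.2 ((h2 a).1 h.symm), ?_⟩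
      funext a
      rw [← restrict t' h2 a, h3]
    funext k
    by_cases h : w k = 0
    · rw [(h2 k).2 h, (ht0 k).2 h]
    · exact congrFun (this.trans htS.symm) ⟨k, h⟩

theorem cubicWeight_nonneg (hd : ∀ k, c k k = 0) (hc : ∀ k l, k ≠ l → 0 < c k l) {t : κ → ℝ}
    (ht : ∀ k, 0 ≤ t k) (k : κ) : 0 ≤ cubicWeight c t k := by
  refine mul_nonneg (sq_nonneg _) (Finset.sum_nonneg fun l _ => mul_nonneg ?_ (ht l))
  by_cases hkl : k = l
  · subst hkl; exact (hd k).ge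
  · exact (hc k l hkl).le

theorem mul_le_cubicWeight (hd : ∀ k, c k k = 0) (hc : ∀ k l, k ≠ l → 0 < c k l) {t : κ → ℝ}
    (ht : ∀ k, 0 ≤ t k) (k l : κ) : t k ^ 2 * (c k l * t l) ≤ cubicWeight c t k := by
  refine mul_le_mul_of_nonneg_left ?_ (sq_nonneg _)
  refine Finset.single_le_sum (f := fun l => c k l * t l) (fun l _ => mul_nonneg ?_ (ht l))
    (Finset.mem_univ l)
  by_cases hkl : k = l
  · subst hkl; exact (hd k).ge
  · exact (hc k l hkl).le

theorem cubicWeight_eq_zero_iff (hd : ∀ k, c k k = 0) (hc : ∀ k l, k ≠ l → 0 < c k l) {t : κ → ℝ}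
    (ht : ∀ k, 0 ≤ t k) (h2 : {k | t k ≠ 0}.Nontrivial) (k : κ) :
    cubicWeight c t k = 0 ↔ t k = 0 := by
  refine ⟨fun h => ?_, fun h => by simp [cubicWeight, h]⟩
  by_contra hk
  obtain ⟨l, hl, hlk⟩ := h2.exists_ne k
  have := mul_le_cubicWeight hd hc ht k l
  have h1 : 0 < t l := (ht l).lt_of_ne (Ne.symm hl)
  have h2 := hc k l hlk.symm
  have : 0 < t k ^ 2 * (c k l * t l) := by positivity
  linarith

theorem cubicWeight_sum_pos (hd : ∀ k, c k k = 0) (hc : ∀ k l, k ≠ l → 0 < c k l) {t : κ → ℝ}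
    (ht : ∀ k, 0 ≤ t k) (h2 : {k | t k ≠ 0}.Nontrivial) : 0 < ∑ k, cubicWeight c t k := by
  obtain ⟨a, ha, -⟩ := id h2
  refine Finset.sum_pos' (fun k _ => cubicWeight_nonneg hd hc ht k) ⟨a, Finset.mem_univ _, ?_⟩
  exact (cubicWeight_nonneg hd hc ht a).lt_of_ne fun h =>
    ha ((cubicWeight_eq_zero_iff hd hc ht h2 a).1 h.symm)

theorem cubicWeight_smul (r : ℝ) (t : κ → ℝ) : cubicWeight c (r • t) = r ^ 3 • cubicWeight c t := by
  funext k
  simp only [cubicWeight, Pi.smul_apply, smul_eq_mul, Finset.mul_sum]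
  refine Finset.sum_congr rfl fun l _ => ?_
  ring

theorem continuous_cubicWeight (k : κ) : Continuous fun t : κ → ℝ => cubicWeight c t k := by
  unfold cubicWeight
  fun_prop

/-- A point of the simplex whose support has at most one element is a vertex. -/
theorem stdSimplex_vertex_of_support {t : κ → ℝ} (ht : t ∈ stdSimplex ℝ κ)
    (h : ¬ {k | t k ≠ 0}.Nontrivial) : ∃ k, t k = 1 ∧ ∀ l, l ≠ k → t l = 0 := by
  rw [Set.not_nontrivial_iff] at h
  obtain ⟨k, -, hk⟩ : ∃ k ∈ Finset.univ, t k ≠ 0 := by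
    refine Finset.exists_ne_zero_of_sum_ne_zero ?_
    rw [ht.2]
    exact one_ne_zero
  have hl : ∀ l, l ≠ k → t l = 0 := fun l hl => by
    by_contra h0
    exact hl (h h0 hk)
  refine ⟨k, ?_, hl⟩
  rw [← ht.2, Finset.sum_eq_single k (fun l _ h => hl l h) (by simp)]

open Classical in
/-- The reparametrization of the simplex by normalized cubic weights. -/
noncomputable def reparamFun (hd : ∀ k, c k k = 0) (hc : ∀ k l, k ≠ l → 0 < c k l)
    (t : stdSimplex ℝ κ) : stdSimplex ℝ κ :=
  if h : {k | t.1 k ≠ 0}.Nontrivial then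
    ⟨fun k => (∑ k, cubicWeight c t.1 k)⁻¹ * cubicWeight c t.1 k,
      fun k => mul_nonneg (inv_nonneg.2 (cubicWeight_sum_pos hd hc t.2.1 h).le)
        (cubicWeight_nonneg hd hc t.2.1 k), by
      rw [← Finset.mul_sum, inv_mul_cancel₀ (cubicWeight_sum_pos hd hc t.2.1 h).ne']⟩
  else t

variable (hd : ∀ k, c k k = 0) (hc : ∀ k l, k ≠ l → 0 < c k l)

theorem reparamFun_apply {t : stdSimplex ℝ κ} (h : {k | t.1 k ≠ 0}.Nontrivial) (k : κ) :
    (reparamFun hd hc t).1 k = (∑ k, cubicWeight c t.1 k)⁻¹ * cubicWeight c t.1 k := by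
  rw [reparamFun, dif_pos h]

theorem reparamFun_of_not {t : stdSimplex ℝ κ} (h : ¬ {k | t.1 k ≠ 0}.Nontrivial) :
    reparamFun hd hc t = t := by
  rw [reparamFun, dif_neg h]

theorem reparamFun_eq_zero_iff (t : stdSimplex ℝ κ) (k : κ) :
    (reparamFun hd hc t).1 k = 0 ↔ t.1 k = 0 := by
  by_cases h : {k | t.1 k ≠ 0}.Nontrivial
  · rw [reparamFun_apply hd hc h, mul_eq_zero, inv_eq_zero,
      or_iff_right (cubicWeight_sum_pos hd hc t.2.1 h).ne',
      cubicWeight_eq_zero_iff hd hc t.2.1 h]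
  · rw [reparamFun_of_not hd hc h]

theorem support_reparamFun (t : stdSimplex ℝ κ) :
    {k | (reparamFun hd hc t).1 k ≠ 0} = {k | t.1 k ≠ 0} := by
  ext k
  simp only [Set.mem_ofPred_eq, ne_eq, reparamFun_eq_zero_iff]

theorem eq_of_smul_eq_of_sum {t t' : stdSimplex ℝ κ} {r : ℝ} (h : t.1 = r • t'.1) : t = t' := by
  have hs := t.2.2
  rw [h] at hs
  simp only [Pi.smul_apply, smul_eq_mul, ← Finset.mul_sum, t'.2.2, mul_one] at hs
  refine Subtype.ext ?_
  rw [h, hs, one_smul]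

theorem injective_reparamFun : Function.Injective (reparamFun hd hc) := by
  intro t t' heq
  have hsupp : {k | t.1 k ≠ 0} = {k | t'.1 k ≠ 0} := by
    rw [← support_reparamFun hd hc t, heq, support_reparamFun]
  by_cases h : {k | t.1 k ≠ 0}.Nontrivial
  · have h' : {k | t'.1 k ≠ 0}.Nontrivial := hsupp ▸ h
    have hW := cubicWeight_sum_pos hd hc t.2.1 h
    have hW' := cubicWeight_sum_pos hd hc t'.2.1 h'
    set W := ∑ k, cubicWeight c t.1 k
    set W' := ∑ k, cubicWeight c t'.1 k
    -- The weights are homogeneous of degree three, so a cube root rescales `t'` to have the same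
    -- weights as `t`; uniqueness then makes the two points proportional.
    obtain ⟨r, hr, hr3⟩ : ∃ r : ℝ, 0 < r ∧ r ^ 3 = W / W' := by
      refine ⟨(W / W') ^ (1 / 3 : ℝ), by positivity, ?_⟩
      rw [← Real.rpow_natCast, ← Real.rpow_mul (by positivity)]
      norm_num
    have hwt : cubicWeight c t.1 = cubicWeight c (r • t'.1) := by
      rw [cubicWeight_smul, hr3]
      funext k
      have := congrArg (fun s => s.1 k) heq
      rw [reparamFun_apply hd hc h, reparamFun_apply hd hc h'] at this
      change W⁻¹ * _ = W'⁻¹ * _ at this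
      rw [Pi.smul_apply, smul_eq_mul]
      field_simp at this ⊢
      linarith
    refine eq_of_smul_eq_of_sum (r := r) ?_
    have hnt : {k | cubicWeight c t.1 k ≠ 0}.Nontrivial := by
      have : {k | cubicWeight c t.1 k ≠ 0} = {k | t.1 k ≠ 0} := by
        ext k
        simp only [Set.mem_ofPred_eq, ne_eq, cubicWeight_eq_zero_iff hd hc t.2.1 h]
      rwa [this]
    refine (existsUnique_cubicWeight hd hc (fun k => cubicWeight_nonneg hd hc t.2.1 k) hnt).unique
      ⟨t.2.1, fun k => (cubicWeight_eq_zero_iff hd hc t.2.1 h k).symm, rfl⟩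
      ⟨fun k => mul_nonneg hr.le (t'.2.1 k), fun k => ?_, hwt.symm⟩
    rw [cubicWeight_eq_zero_iff hd hc t.2.1 h, Pi.smul_apply, smul_eq_mul, mul_eq_zero,
      or_iff_right hr.ne']
    have := Set.ext_iff.1 hsupp k
    simp only [Set.mem_ofPred_eq] at this
    exact (not_iff_not.1 this).symm
  · rw [← reparamFun_of_not hd hc h, heq, reparamFun_of_not hd hc (hsupp ▸ h)]

theorem surjective_reparamFun : Function.Surjective (reparamFun hd hc) := by
  intro w
  by_cases h : {k | w.1 k ≠ 0}.Nontrivial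
  · obtain ⟨t, ⟨h1, h2, h3⟩, -⟩ := existsUnique_cubicWeight hd hc w.2.1 h
    have hsupp : {k | t k ≠ 0} = {k | w.1 k ≠ 0} := by
      ext k
      simp only [Set.mem_ofPred_eq, ne_eq, h2]
    have hpos : 0 < ∑ k, t k := by
      obtain ⟨a, ha, -⟩ := hsupp ▸ h
      exact Finset.sum_pos' (fun k _ => h1 k) ⟨a, Finset.mem_univ _, (h1 a).lt_of_ne (Ne.symm ha)⟩
    let τ : stdSimplex ℝ κ := ⟨(∑ k, t k)⁻¹ • t, fun k => mul_nonneg (by positivity) (h1 k), by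
      simp only [Pi.smul_apply, smul_eq_mul]
      rw [← Finset.mul_sum, inv_mul_cancel₀ hpos.ne']⟩
    have hτ : {k | τ.1 k ≠ 0}.Nontrivial := by
      have : {k | τ.1 k ≠ 0} = {k | t k ≠ 0} := by
        ext k
        simp [τ, hpos.ne']
      rw [this, hsupp]
      exact h
    refine ⟨τ, Subtype.ext (funext fun k => ?_)⟩
    rw [reparamFun_apply hd hc hτ]
    simp only [τ, cubicWeight_smul, h3, Pi.smul_apply, smul_eq_mul]
    rw [← Finset.mul_sum, w.2.2]
    field_simp
  · exact ⟨w, reparamFun_of_not hd hc h⟩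

/-- This bound gives continuity at a vertex, where all cubic weights vanish and the normalization
degenerates. The weight of `l` is at most a constant times `t l ^ 2`, while the total is at least `t
k ^ 2 * c k l * t l`, so the quotient is of order `t l` near the vertex `k`. -/
theorem reparamFun_le {t : stdSimplex ℝ κ} {k l : κ} (hk : 0 < t.1 k) (hl : l ≠ k) :
    (reparamFun hd hc t).1 l ≤ t.1 l * (∑ j, c l j) / (t.1 k ^ 2 * c k l) := by
  have hckl := hc k l hl.symm
  have hcl : ∀ j, 0 ≤ c l j := fun j => by
    by_cases h : l = j
    · subst h; exact (hd l).ge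
    · exact (hc l j h).le
  have hS : 0 ≤ ∑ j, c l j := Finset.sum_nonneg fun j _ => hcl j
  rcases (t.2.1 l).eq_or_lt with h0 | h0
  · rw [(reparamFun_eq_zero_iff hd hc t l).2 h0.symm, ← h0]
    simp
  · have h : {k | t.1 k ≠ 0}.Nontrivial := ⟨l, h0.ne', k, hk.ne', hl⟩
    have hW := cubicWeight_sum_pos hd hc t.2.1 h
    have h1 : t.1 k ^ 2 * (c k l * t.1 l) ≤ ∑ j, cubicWeight c t.1 j :=
      (mul_le_cubicWeight hd hc t.2.1 k l).trans
        (Finset.single_le_sum (f := fun j => cubicWeight c t.1 j)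
          (fun j _ => cubicWeight_nonneg hd hc t.2.1 j) (Finset.mem_univ k))
    have h2 : cubicWeight c t.1 l ≤ t.1 l ^ 2 * ∑ j, c l j := by
      refine mul_le_mul_of_nonneg_left (Finset.sum_le_sum fun j _ => ?_) (sq_nonneg _)
      have : t.1 j ≤ 1 := by
        rw [← t.2.2]
        exact Finset.single_le_sum (fun j _ => t.2.1 j) (Finset.mem_univ j)
      exact mul_le_of_le_one_right (hcl j) this
    rw [reparamFun_apply hd hc h, inv_mul_eq_div, div_le_div_iff₀ hW (by positivity)]
    calc cubicWeight c t.1 l * (t.1 k ^ 2 * c k l)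
        ≤ (t.1 l ^ 2 * ∑ j, c l j) * (t.1 k ^ 2 * c k l) :=
          mul_le_mul_of_nonneg_right h2 (by positivity)
      _ = (t.1 l * ∑ j, c l j) * (t.1 k ^ 2 * (c k l * t.1 l)) := by ring
      _ ≤ (t.1 l * ∑ j, c l j) * ∑ j, cubicWeight c t.1 j :=
          mul_le_mul_of_nonneg_left h1 (mul_nonneg h0.le hS)

theorem continuous_reparamFun : Continuous (reparamFun hd hc) := by
  classical
  have hcoord : ∀ k, Continuous fun t : stdSimplex ℝ κ => t.1 k := fun k =>
    (continuous_apply k).comp continuous_subtype_val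
  refine continuous_iff_continuousAt.2 fun t₀ => ?_
  rw [Topology.IsInducing.subtypeVal.continuousAt_iff, continuousAt_pi]
  by_cases h : {k | t₀.1 k ≠ 0}.Nontrivial
  · intro k
    obtain ⟨a, ha, b, hb, hab⟩ := id h
    have hev : ∀ᶠ t : stdSimplex ℝ κ in nhds t₀, {k | t.1 k ≠ 0}.Nontrivial := by
      filter_upwards [(hcoord a).continuousAt.eventually_ne ha,
        (hcoord b).continuousAt.eventually_ne hb] with t h1 h2
      exact ⟨a, h1, b, h2, hab⟩
    have hwt : ∀ k, Continuous fun t : stdSimplex ℝ κ => cubicWeight c t.1 k := fun k =>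
      (continuous_cubicWeight k).comp continuous_subtype_val
    refine ContinuousAt.congr (f := fun t : stdSimplex ℝ κ =>
      (∑ k, cubicWeight c t.1 k)⁻¹ * cubicWeight c t.1 k) ?_ ?_
    · exact ((continuous_finsetSum _ fun k _ => hwt k).continuousAt.inv₀
        (cubicWeight_sum_pos hd hc t₀.2.1 h).ne').mul (hwt k).continuousAt
    · filter_upwards [hev] with t ht
      exact (reparamFun_apply hd hc ht k).symm
  · obtain ⟨k, hk, hl⟩ := stdSimplex_vertex_of_support t₀.2 h
    have hlim : ∀ l, l ≠ k → Filter.Tendsto (fun t => (reparamFun hd hc t).1 l) (nhds t₀)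
        (nhds 0) := by
      intro l hlk
      have hpos : ∀ᶠ t : stdSimplex ℝ κ in nhds t₀, 0 < t.1 k :=
        (hcoord k).continuousAt.eventually_const_lt (by simp [hk])
      have hb : Filter.Tendsto (fun t : stdSimplex ℝ κ =>
          t.1 l * (∑ j, c l j) / (t.1 k ^ 2 * c k l)) (nhds t₀) (nhds 0) := by
        have : ContinuousAt (fun t : stdSimplex ℝ κ =>
            t.1 l * (∑ j, c l j) / (t.1 k ^ 2 * c k l)) t₀ := by
          refine ContinuousAt.div ((hcoord l).continuousAt.mul continuousAt_const)
            (((hcoord k).continuousAt.pow 2).mul continuousAt_const) ?_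
          rw [hk]
          have := hc k l hlk.symm
          positivity
        have h0 := this.tendsto
        rwa [hl l hlk, zero_mul, zero_div] at h0
      refine squeeze_zero' (Filter.Eventually.of_forall fun t => (reparamFun hd hc t).2.1 l) ?_ hb
      filter_upwards [hpos] with t ht
      exact reparamFun_le hd hc ht hlk
    -- The coordinate at the vertex itself is controlled as one minus the sum of the others.
    have hsum : ∀ t : stdSimplex ℝ κ,
        1 - ∑ l ∈ Finset.univ.erase k, t.1 l = t.1 k := fun t => by
      rw [sub_eq_iff_eq_add, ← t.2.2, add_comm, Finset.sum_erase_add _ _ (Finset.mem_univ k)]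
    intro l
    by_cases hlk : l = k
    · subst hlk
      have := tendsto_const_nhds (x := (1 : ℝ)) |>.sub
        (tendsto_finsetSum (Finset.univ.erase l) fun j hj => hlim j (Finset.ne_of_mem_erase hj))
      simp only [hsum, Finset.sum_const_zero, sub_zero] at this
      simpa [ContinuousAt, reparamFun_of_not hd hc h, hk] using this
    · simpa [ContinuousAt, reparamFun_of_not hd hc h, hl l hlk] using hlim l hlk

/-- Cubic weights give a face preserving homeomorphism of the simplex. -/
noncomputable def reparam : stdSimplex ℝ κ ≃ₜ stdSimplex ℝ κ :=
  Continuous.homeoOfEquivCompactToT2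
    (f := Equiv.ofBijective _ ⟨injective_reparamFun hd hc, surjective_reparamFun hd hc⟩)
    (continuous_reparamFun hd hc)

theorem reparam_apply (t : stdSimplex ℝ κ) : reparam hd hc t = reparamFun hd hc t := rfl

end Reparam

/-! ## Light-like vectors and points of hyperbolic space -/

/-- The light-like Hermitian matrix `u u*`. -/
def lightMat (u : Fin 2 → ℂ) : Matrix (Fin 2) (Fin 2) ℂ := Matrix.vecMulVec u (star u)

theorem lightMat_smul (a : ℂ) (u : Fin 2 → ℂ) :
    lightMat (a • u) = ((‖a‖ ^ 2 : ℝ) : ℂ) • lightMat u := by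
  have h : a * star a = ((‖a‖ ^ 2 : ℝ) : ℂ) := by
    rw [Complex.star_def, Complex.mul_conj, Complex.normSq_eq_norm_sq]
  ext i j
  rw [← h]
  simp only [lightMat, Matrix.vecMulVec_apply, Matrix.smul_apply, Pi.smul_apply, Pi.star_apply,
    smul_eq_mul, star_mul']
  ring

theorem mul_lightMat_mul (s : Matrix (Fin 2) (Fin 2) ℂ) (u : Fin 2 → ℂ) :
    s * lightMat u * s.conjTranspose = lightMat (s.mulVec u) := by
  rw [lightMat, lightMat, Matrix.mul_vecMulVec, Matrix.vecMulVec_mul, Matrix.star_mulVec]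

theorem center_conj (z : Matrix.SpecialLinearGroup (Fin 2) ℂ)
    (hz : z ∈ Subgroup.center (Matrix.SpecialLinearGroup (Fin 2) ℂ))
    (M : Matrix (Fin 2) (Fin 2) ℂ) : z.1 * M * z.1.conjTranspose = M := by
  obtain ⟨r, hr, hz⟩ := Matrix.SpecialLinearGroup.mem_center_iff.mp hz
  have h1 : r * star r = 1 := by
    have h2 : ‖r‖ ^ 2 = 1 := by
      rw [← norm_pow]
      simpa using congrArg norm hr
    rw [Complex.star_def, Complex.mul_conj, Complex.normSq_eq_norm_sq, h2]
    simp
  have h3 : z.1 = r • (1 : Matrix (Fin 2) (Fin 2) ℂ) := by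
    rw [← hz, Matrix.scalar_apply, Matrix.smul_one_eq_diagonal]
  rw [h3, Matrix.conjTranspose_smul, Matrix.conjTranspose_one, Matrix.smul_mul, Matrix.mul_smul,
    Matrix.smul_mul, Matrix.mul_one, Matrix.one_mul, smul_smul, mul_comm, h1, one_smul]

/-- The action of `PSL₂(ℂ)` on Minkowski space. -/
noncomputable def actMat (g : PSL2C) (M : Matrix (Fin 2) (Fin 2) ℂ) : Matrix (Fin 2) (Fin 2) ℂ :=
  (Quotient.out g).1 * M * (Quotient.out g).1.conjTranspose

/-- Two lifts differ by a central element, a scalar of modulus one, which acts trivially by `M ↦ z M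
z*`. -/
theorem actMat_mk (s : Matrix.SpecialLinearGroup (Fin 2) ℂ) (M : Matrix (Fin 2) (Fin 2) ℂ) :
    actMat (QuotientGroup.mk s) M = s.1 * M * s.1.conjTranspose := by
  have h : (QuotientGroup.mk (Quotient.out (QuotientGroup.mk s : PSL2C)) : PSL2C)
      = QuotientGroup.mk s := QuotientGroup.out_eq' _
  have hc := center_conj _ (QuotientGroup.eq.1 h) M
  rw [actMat]
  generalize Quotient.out (QuotientGroup.mk s : PSL2C) = s' at *
  conv_lhs => rw [← hc]
  have : s.1 = s'.1 * (s'⁻¹ * s).1 := congrArg Subtype.val (mul_inv_cancel_left s' s).symm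
  rw [this, Matrix.conjTranspose_mul]
  simp only [Matrix.mul_assoc]

theorem actMat_mul (g h : PSL2C) (M : Matrix (Fin 2) (Fin 2) ℂ) :
    actMat (g * h) M = actMat g (actMat h M) := by
  induction g using QuotientGroup.induction_on with
  | H g =>
  induction h using QuotientGroup.induction_on with
  | H h =>
  rw [← QuotientGroup.mk_mul, actMat_mk, actMat_mk, actMat_mk]
  change (g.1 * h.1) * M * (g.1 * h.1).conjTranspose = _
  rw [Matrix.conjTranspose_mul]
  simp only [Matrix.mul_assoc]

theorem actMat_smul (g : PSL2C) (a : ℂ) (M : Matrix (Fin 2) (Fin 2) ℂ) :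
    actMat g (a • M) = a • actMat g M := by
  simp [actMat]

theorem actMat_sum (g : PSL2C) {κ : Type*} (s : Finset κ) (M : κ → Matrix (Fin 2) (Fin 2) ℂ) :
    actMat g (∑ k ∈ s, M k) = ∑ k ∈ s, actMat g (M k) := by
  simp [actMat, Finset.mul_sum, Finset.sum_mul]

theorem det_actMat (g : PSL2C) (M : Matrix (Fin 2) (Fin 2) ℂ) : (actMat g M).det = M.det := by
  simp [actMat, Matrix.det_mul, Matrix.det_conjTranspose]

theorem smul_H3_val (g : PSL2C) (A : H3) : (g • A).1 = actMat g A.1 := by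
  induction g using QuotientGroup.induction_on with
  | H g =>
  rw [actMat_mk]
  rfl

theorem actMat_lightMat (g : PSL2C) (u : Fin 2 → ℂ) (hu : u ≠ 0) :
    ∃ (w : Fin 2 → ℂ) (hw : w ≠ 0), actMat g (lightMat u) = lightMat w ∧
      Projectivization.mk ℂ w hw = g • Projectivization.mk ℂ u hu := by
  induction g using QuotientGroup.induction_on with
  | H g =>
  obtain ⟨h, he⟩ := psl_mk_smul_mk g u hu
  exact ⟨_, h, by rw [actMat_mk, mul_lightMat_mul], he.symm⟩

theorem posSemidef_lightMat (u : Fin 2 → ℂ) : (lightMat u).PosSemidef :=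
  Matrix.posSemidef_vecMulVec_self_star u

theorem posSemidef_smul_lightMat {a : ℝ} (ha : 0 ≤ a) (u : Fin 2 → ℂ) :
    ((a : ℂ) • lightMat u).PosSemidef :=
  (posSemidef_lightMat u).smul (by exact_mod_cast ha)

/-- Two terms suffice: the determinant of `a u u* + b v v*` is `a b |det (u, v)| ^ 2`, nonzero for
distinct lines. The remaining terms are positive semidefinite. -/
theorem posDef_sum_lightMat {κ : Type*} [Fintype κ] {u : κ → Fin 2 → ℂ} (hu : ∀ k, u k ≠ 0)
    (hne : ∀ k l, k ≠ l → Projectivization.mk ℂ (u k) (hu k) ≠ Projectivization.mk ℂ (u l) (hu l))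
    {w : κ → ℝ} (hw : ∀ k, 0 ≤ w k) (h2 : {k | w k ≠ 0}.Nontrivial) :
    (∑ k, (w k : ℂ) • lightMat (u k)).PosDef := by
  classical
  obtain ⟨a, ha, b, hb, hab⟩ := h2
  rw [← Finset.add_sum_erase _ _ (Finset.mem_univ a),
    ← Finset.add_sum_erase _ _ (Finset.mem_erase.2 ⟨hab.symm, Finset.mem_univ b⟩), ← add_assoc]
  refine Matrix.PosDef.add_posSemidef ?_
    (Matrix.posSemidef_sum _ fun k _ => posSemidef_smul_lightMat (hw k) _)
  refine (((posSemidef_smul_lightMat (hw a) _).add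
    (posSemidef_smul_lightMat (hw b) _)).posDef_iff_det_ne_zero).2 ?_
  have hd := det_ne_zero_of_mk_ne _ _ (hne a b hab)
  have : ((w a : ℂ) • lightMat (u a) + (w b : ℂ) • lightMat (u b)).det
      = w a * w b * ((u a 0 * u b 1 - u a 1 * u b 0) * star (u a 0 * u b 1 - u a 1 * u b 0)) := by
    rw [Matrix.det_fin_two]
    simp only [lightMat, Matrix.add_apply, Matrix.smul_apply, Matrix.vecMulVec_apply,
      Pi.star_apply, smul_eq_mul, star_sub, star_mul']
    ring
  rw [this]
  have ha' : (w a : ℂ) ≠ 0 := by exact_mod_cast ha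
  have hb' : (w b : ℂ) ≠ 0 := by exact_mod_cast hb
  exact mul_ne_zero (mul_ne_zero ha' hb') (mul_ne_zero hd (star_ne_zero.2 hd))

theorem det_eq_re_of_posDef {A : Matrix (Fin 2) (Fin 2) ℂ} (hA : A.PosDef) :
    0 < A.det.re ∧ ((A.det.re : ℝ) : ℂ) = A.det := by
  have h := Complex.pos_iff.1 hA.det_pos
  exact ⟨h.1, Complex.ext rfl (by simpa using h.2)⟩

/-- The scale that projects a positive definite matrix to hyperbolic space. -/
noncomputable def hypScale (A : Matrix (Fin 2) (Fin 2) ℂ) : ℝ := (Real.sqrt A.det.re)⁻¹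

theorem hypScale_pos {A : Matrix (Fin 2) (Fin 2) ℂ} (hA : A.PosDef) : 0 < hypScale A :=
  inv_pos.2 (Real.sqrt_pos.2 (det_eq_re_of_posDef hA).1)

/-- The projection of a positive definite matrix to hyperbolic space. -/
noncomputable def toH3 (A : Matrix (Fin 2) (Fin 2) ℂ) (hA : A.PosDef) : H3 :=
  ⟨(hypScale A : ℂ) • A, hA.smul (by exact_mod_cast hypScale_pos hA), by
    obtain ⟨h0, h1⟩ := det_eq_re_of_posDef hA
    rw [Matrix.det_smul, Fintype.card_fin, ← h1, ← Complex.ofReal_pow, ← Complex.ofReal_mul,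
      hypScale, inv_pow, Real.sq_sqrt h0.le, inv_mul_cancel₀ h0.ne', Complex.ofReal_one]⟩

theorem toH3_actMat (g : PSL2C) (A : Matrix (Fin 2) (Fin 2) ℂ) (hA : A.PosDef)
    (hA' : (actMat g A).PosDef) : toH3 (actMat g A) hA' = g • toH3 A hA := by
  refine Subtype.ext ?_
  rw [smul_H3_val]
  simp only [toH3]
  rw [actMat_smul, hypScale, det_actMat, hypScale]

theorem continuous_toH3 {X : Type*} [TopologicalSpace X] {A : X → Matrix (Fin 2) (Fin 2) ℂ}
    (hA : ∀ x, (A x).PosDef) (hc : Continuous A) : Continuous fun x => toH3 (A x) (hA x) := by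
  refine Continuous.subtype_mk ?_ _
  have h1 : Continuous fun x => (A x).det.re := Complex.continuous_re.comp hc.matrix_det
  have h2 : Continuous fun x => hypScale (A x) :=
    (Real.continuous_sqrt.comp h1).inv₀ fun x =>
      (Real.sqrt_pos.2 (det_eq_re_of_posDef (hA x)).1).ne'
  exact (Complex.continuous_ofReal.comp h2).smul hc

/-! ## Equivariant light-like vectors at the edges of the developed triangulation -/

namespace IdealTriangulation

variable {ι : Type*} (T : IdealTriangulation ι) {Z : ι → Fin 3 → ℂ} (hz : ∀ i, IsShape (Z i))

/-- Two oriented edges of developed tetrahedra are equivalent if they are identified in the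
developed space up to the action of `PSL₂(ℂ)`. -/
def edgeSetoid : Setoid (Developed Z × Fin 4 × Fin 4) where
  r x y := ∃ g : PSL2C, T.DevelopedEdgeRel hz (g • x.1, x.2) y
  iseqv := {
    refl := fun x => ⟨1, by rw [one_smul]; exact .refl _⟩
    symm := by
      rintro x y ⟨g, h⟩
      refine ⟨g⁻¹, ?_⟩
      have := T.developedEdgeRel_smul hz g⁻¹ h
      simp only [inv_smul_smul] at this
      exact this.symm
    trans := by
      rintro x y w ⟨g, h⟩ ⟨g', h'⟩
      refine ⟨g' * g, ?_⟩
      have := T.developedEdgeRel_smul hz g' h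
      simp only [← mul_smul] at this
      exact this.trans _ _ _ h' }

/-- A representative of each class of edges. -/
noncomputable def edgeRep (x : Developed Z × Fin 4 × Fin 4) : Developed Z × Fin 4 × Fin 4 :=
  Quotient.out (Quotient.mk (T.edgeSetoid hz) x)

theorem exists_edgeElt (x : Developed Z × Fin 4 × Fin 4) :
    ∃ g : PSL2C, T.DevelopedEdgeRel hz (g • (T.edgeRep hz x).1, (T.edgeRep hz x).2) x :=
  Quotient.exact (s := T.edgeSetoid hz) (Quotient.out_eq _)

/-- The group element taking the representative of an edge to the edge. -/
noncomputable def edgeElt (x : Developed Z × Fin 4 × Fin 4) : PSL2C := (T.exists_edgeElt hz x).choose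

theorem edgeElt_spec (x : Developed Z × Fin 4 × Fin 4) :
    T.DevelopedEdgeRel hz (T.edgeElt hz x • (T.edgeRep hz x).1, (T.edgeRep hz x).2) x :=
  (T.exists_edgeElt hz x).choose_spec

theorem edgeRep_eq {x y : Developed Z × Fin 4 × Fin 4} {g : PSL2C}
    (h : T.DevelopedEdgeRel hz (g • x.1, x.2) y) : T.edgeRep hz x = T.edgeRep hz y :=
  congrArg Quotient.out (Quotient.sound (s := T.edgeSetoid hz) ⟨g, h⟩)

theorem ends_ne_of_developedEdgeRel {x y : Developed Z × Fin 4 × Fin 4}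
    (h : T.DevelopedEdgeRel hz x y) : x.2.1 ≠ x.2.2 ↔ y.2.1 ≠ y.2.2 := by
  induction h with
  | rel x y h =>
    obtain ⟨x, f, a, b, ha, hb⟩ := h
    exact (((T.developed hz).glue x f).injective.ne_iff).symm
  | refl => exact Iff.rfl
  | symm _ _ _ ih => exact ih.symm
  | trans _ _ _ _ _ ih ih' => exact ih.trans ih'

/-- Both elements take the common representative to edges identified with `y`, and the action on
edges is free. Hence the chosen group elements, and with them `edgeLight`, are equivariant and
compatible with face pairings. -/
theorem edgeElt_eq [Fintype ι] (hZ : Z ∈ T.deformationVariety)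
    {x y : Developed Z × Fin 4 × Fin 4} (hx : x.2.1 ≠ x.2.2) {g : PSL2C}
    (h : T.DevelopedEdgeRel hz (g • x.1, x.2) y) : T.edgeElt hz y = g * T.edgeElt hz x := by
  have h1 := T.developedEdgeRel_smul hz g (T.edgeElt_spec hz x)
  have h2 := (h1.trans _ _ _ h).trans _ _ _ (T.edgeElt_spec hz y).symm
  have hne := (T.ends_ne_of_developedEdgeRel hz (T.edgeElt_spec hz x)).2 hx
  rw [← T.edgeRep_eq hz h] at h2
  simp only [← mul_smul] at h2
  exact (T.eq_of_developedEdgeRel_smul hz hZ hne h2).symm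

/-- A light-like vector on the ray of the initial point of an edge. -/
noncomputable def edgeLight (x : Developed Z × Fin 4 × Fin 4) : Matrix (Fin 2) (Fin 2) ℂ :=
  actMat (T.edgeElt hz x)
    (lightMat ((T.edgeRep hz x).1.1.2 (T.edgeRep hz x).2.1).rep)

theorem edgeLight_eq [Fintype ι] (hZ : Z ∈ T.deformationVariety)
    {x y : Developed Z × Fin 4 × Fin 4} (hx : x.2.1 ≠ x.2.2) {g : PSL2C}
    (h : T.DevelopedEdgeRel hz (g • x.1, x.2) y) :
    T.edgeLight hz y = actMat g (T.edgeLight hz x) := by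
  rw [edgeLight, edgeLight, T.edgeElt_eq hz hZ hx h, T.edgeRep_eq hz h, actMat_mul]

theorem edgeLight_smul [Fintype ι] (hZ : Z ∈ T.deformationVariety) (g : PSL2C) (x : Developed Z)
    {a b : Fin 4} (hab : a ≠ b) :
    T.edgeLight hz (g • x, a, b) = actMat g (T.edgeLight hz (x, a, b)) :=
  T.edgeLight_eq hz hZ hab (.refl _)

theorem actMat_one (M : Matrix (Fin 2) (Fin 2) ℂ) : actMat 1 M = M := by
  rw [← QuotientGroup.mk_one, actMat_mk]
  simp

theorem edgeLight_adj [Fintype ι] (hZ : Z ∈ T.deformationVariety) (x : Developed Z)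
    {f a b : Fin 4} (ha : a ≠ f) (hb : b ≠ f) (hab : a ≠ b) :
    T.edgeLight hz (T.developedAdj hz x f, T.glue x.1.1 f a, T.glue x.1.1 f b)
      = T.edgeLight hz (x, a, b) := by
  rw [T.edgeLight_eq hz hZ (x := (x, a, b)) (g := 1) hab, actMat_one]
  rw [one_smul]
  exact .rel _ _ (.step (adj := (T.developed hz).adj) (glue := (T.developed hz).glue) x f a b ha hb)

theorem exists_edgeLight_eq (x : Developed Z × Fin 4 × Fin 4) :
    ∃ (w : Fin 2 → ℂ) (hw : w ≠ 0), T.edgeLight hz x = lightMat w ∧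
      Projectivization.mk ℂ w hw = x.1.1.2 x.2.1 := by
  obtain ⟨w, hw, h1, h2⟩ := actMat_lightMat (T.edgeElt hz x)
    ((T.edgeRep hz x).1.1.2 (T.edgeRep hz x).2.1).rep (Projectivization.rep_nonzero _)
  refine ⟨w, hw, h1, ?_⟩
  rw [h2, Projectivization.mk_rep]
  exact T.vertex_eq_of_developedEdgeRel hz (T.edgeElt_spec hz x)

theorem exists_edgeLight_smul (x : Developed Z) (a b : Fin 4) {u : Fin 2 → ℂ} (hu : u ≠ 0)
    (h : Projectivization.mk ℂ u hu = x.1.2 a) :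
    ∃ c : ℝ, 0 < c ∧ T.edgeLight hz (x, a, b) = (c : ℂ) • lightMat u := by
  obtain ⟨w, hw, h1, h2⟩ := T.exists_edgeLight_eq hz (x, a, b)
  obtain ⟨r, hr⟩ := (Projectivization.mk_eq_mk_iff' ℂ _ _ _ _).1 (h2.trans h.symm)
  have hr0 : r ≠ 0 := by
    rintro rfl
    exact hw (by rw [← hr, zero_smul])
  exact ⟨‖r‖ ^ 2, by positivity, by rw [h1, ← hr, lightMat_smul]⟩

/-! ## The straight map of the developed space -/

/-- The sum of the light-like vectors of the edges of a tetrahedron, weighted by the coordinates of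
a point. -/
noncomputable def devSum (x : Developed Z) (t : Fin 4 → ℝ) : Matrix (Fin 2) (Fin 2) ℂ :=
  ∑ k, ∑ l, if k = l then 0 else ((t k ^ 2 * t l : ℝ) : ℂ) • T.edgeLight hz (x, k, l)

theorem devSum_smul [Fintype ι] (hZ : Z ∈ T.deformationVariety) (g : PSL2C) (x : Developed Z)
    (t : Fin 4 → ℝ) : T.devSum hz (g • x) t = actMat g (T.devSum hz x t) := by
  simp only [devSum, actMat_sum]
  refine Finset.sum_congr rfl fun k _ => Finset.sum_congr rfl fun l _ => ?_
  split_ifs with h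
  · simp [actMat]
  · rw [actMat_smul, T.edgeLight_smul hz hZ g x h]

/-- On the face opposite to `f`, every term with an edge at `f` contains the factor `t f = 0`. The
other edges lie in the face, and their vectors are the same for both tetrahedra. -/
theorem devSum_adj [Fintype ι] (hZ : Z ∈ T.deformationVariety) (x : Developed Z) (f : Fin 4)
    (t : IdealSimplex) (ht : t.1 f = 0) :
    T.devSum hz (T.developedAdj hz x f) (t.permute (T.glue x.1.1 f)).1 = T.devSum hz x t.1 := by
  simp only [devSum]
  rw [← Equiv.sum_comp (T.glue x.1.1 f)]
  refine Finset.sum_congr rfl fun k _ => ?_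
  rw [← Equiv.sum_comp (T.glue x.1.1 f)]
  refine Finset.sum_congr rfl fun l _ => ?_
  simp only [IdealSimplex.permute_apply, (T.glue x.1.1 f).injective.eq_iff]
  split_ifs with h
  · rfl
  · by_cases hk : k = f
    · subst hk; simp [ht]
    · by_cases hl : l = f
      · subst hl; simp [ht]
      · rw [T.edgeLight_adj hz hZ x hk hl h]

theorem continuous_devSum (x : Developed Z) : Continuous (T.devSum hz x) := by
  unfold devSum
  refine continuous_finsetSum _ fun k _ => continuous_finsetSum _ fun l _ => ?_
  split_ifs
  · exact continuous_const
  · refine (Complex.continuous_ofReal.comp ?_).smul continuous_const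
    fun_prop

/-- The coefficients of the light-like vectors of the edges with respect to representatives of the
ideal vertices. -/
theorem exists_devSum_eq (x : Developed Z) :
    ∃ c : Fin 4 → Fin 4 → ℝ, (∀ k, c k k = 0) ∧ (∀ k l, k ≠ l → 0 < c k l) ∧
      ∀ t, T.devSum hz x t = ∑ k, (cubicWeight c t k : ℂ) • lightMat (x.1.2 k).rep := by
  choose c hc0 hc using fun k l => T.exists_edgeLight_smul hz x k l
    (Projectivization.rep_nonzero (x.1.2 k)) (Projectivization.mk_rep _)
  refine ⟨fun k l => if k = l then 0 else c k l, by simp, fun k l h => by simp [h, hc0], ?_⟩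
  intro t
  simp only [devSum]
  refine Finset.sum_congr rfl fun k _ => ?_
  rw [cubicWeight, Finset.mul_sum, Complex.ofReal_sum, Finset.sum_smul]
  refine Finset.sum_congr rfl fun l _ => ?_
  split_ifs with h
  · simp
  · rw [hc, smul_smul, ← Complex.ofReal_mul]
    congr 2
    ring

theorem _root_.IdealHyp.IdealSimplex.support_nontrivial (t : IdealSimplex) :
    {k | t.1 k ≠ 0}.Nontrivial := by
  by_contra h
  obtain ⟨k, hk, -⟩ := stdSimplex_vertex_of_support t.2.1 h
  exact t.2.2 k hk

theorem posDef_devSum (x : Developed Z) (t : IdealSimplex) : (T.devSum hz x t.1).PosDef := by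
  obtain ⟨c, hd, hc, h⟩ := T.exists_devSum_eq hz x
  rw [h]
  refine posDef_sum_lightMat (fun k => Projectivization.rep_nonzero _) (fun k l hkl => ?_)
    (cubicWeight_nonneg hd hc t.2.1.1) ?_
  · rw [Projectivization.mk_rep, Projectivization.mk_rep]
    exact (x.2.injective (hz _)).ne hkl
  · have : {k | cubicWeight c t.1 k ≠ 0} = {k | t.1 k ≠ 0} := by
      ext k
      simp only [Set.mem_ofPred_eq, ne_eq,
        cubicWeight_eq_zero_iff hd hc t.2.1.1 t.support_nontrivial]
    rw [this]
    exact t.support_nontrivial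

/-- The straight map of a developed tetrahedron. -/
noncomputable def devTet (x : Developed Z) (t : IdealSimplex) : H3 :=
  toH3 (T.devSum hz x t.1) (T.posDef_devSum hz x t)

/-- With respect to representatives of the ideal vertices, the coefficients are cubic weights in
`t`. Dividing by their sum gives the coordinates of `reparam`; the sum is absorbed into the positive
scale. -/
theorem isStraight_devTet (x : Developed Z) : IsStraight x.1.2 (T.devTet hz x) := by
  obtain ⟨c, hd, hc, h⟩ := T.exists_devSum_eq hz x
  refine ⟨fun k => (x.1.2 k).rep, fun k => ⟨Projectivization.rep_nonzero _,
    Projectivization.mk_rep _⟩, reparam hd hc, reparamFun_eq_zero_iff hd hc, fun t => ?_⟩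
  have hW := cubicWeight_sum_pos hd hc t.2.1.1 t.support_nontrivial
  refine ⟨hypScale (T.devSum hz x t.1) * ∑ k, cubicWeight c t.1 k,
    mul_pos (hypScale_pos (T.posDef_devSum hz x t)) hW, ?_⟩
  change (hypScale (T.devSum hz x t.1) : ℂ) • T.devSum hz x t.1 = _
  rw [Complex.ofReal_mul, mul_smul]
  congr 1
  rw [h, Finset.smul_sum]
  refine Finset.sum_congr rfl fun k _ => ?_
  have happ := reparamFun_apply hd hc (t := t.toSimplex) t.support_nontrivial k
  rw [reparam_apply, happ, smul_smul, ← Complex.ofReal_mul]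
  change _ = (((∑ k, cubicWeight c t.1 k) * ((∑ k, cubicWeight c t.1 k)⁻¹ * cubicWeight c t.1 k) :
    ℝ) : ℂ) • _
  rw [mul_inv_cancel_left₀ hW.ne']
  rfl

theorem continuous_devTet (x : Developed Z) : Continuous (T.devTet hz x) :=
  continuous_toH3 (fun t : IdealSimplex => T.posDef_devSum hz x t)
    ((T.continuous_devSum hz x).comp continuous_subtype_val)

theorem devTet_smul [Fintype ι] (hZ : Z ∈ T.deformationVariety) (g : PSL2C) (x : Developed Z)
    (t : IdealSimplex) : T.devTet hz (g • x) t = g • T.devTet hz x t := by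
  have h := T.posDef_devSum hz (g • x) t
  rw [T.devSum_smul hz hZ] at h
  rw [devTet, devTet, ← toH3_actMat g _ _ h]
  congr 1
  exact T.devSum_smul hz hZ g x t.1

/-- The developing map of the developed space. -/
noncomputable def devMap [Fintype ι] (hZ : Z ∈ T.deformationVariety) :
    (T.developed hz).Space → H3 :=
  Quot.lift (fun a => T.devTet hz a.1 a.2) (by
    rintro _ _ ⟨x, f, t, ht⟩
    simp only [devTet, developed_adj, developed_glue]
    congr 1
    exact (T.devSum_adj hz hZ x f t ht).symm)

theorem devMap_char [Fintype ι] (hZ : Z ∈ T.deformationVariety) (x : Developed Z)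
    (t : IdealSimplex) : T.devMap hz hZ ((T.developed hz).char x t) = T.devTet hz x t := rfl

theorem continuous_devMap [Fintype ι] (hZ : Z ∈ T.deformationVariety) :
    Continuous (T.devMap hz hZ) :=
  (T.developed hz).continuous_space_iff.2 fun x => T.continuous_devTet hz x

theorem devMap_smul [Fintype ι] (hZ : Z ∈ T.deformationVariety) (g : PSL2C)
    (d : (T.developed hz).Space) : T.devMap hz hZ (g • d) = g • T.devMap hz hZ d := by
  obtain ⟨x, t, rfl⟩ := (T.developed hz).exists_eq_char d
  rw [smul_developed_char, devMap_char, devMap_char, T.devTet_smul hz hZ]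

end IdealTriangulation

/-! ## Coverings and deck transformations -/

section Covering

variable {E X : Type*} [TopologicalSpace E] [TopologicalSpace X] {p : E → X}

/-- A space with a local homeomorphism to a locally path connected space is locally path
connected. -/
theorem locallyPathConnectedSpace_of_isLocalHomeomorph [LocallyPathConnectedSpace X]
    (hp : IsLocalHomeomorph p) : LocallyPathConnectedSpace E := by
  choose e he _ using hp
  let _ : ChartedSpace X E :=
    { atlas := Set.range e
      chartAt := e
      mem_chart_source := he
      chart_mem_atlas := fun x => ⟨x, rfl⟩ }
  exact ChartedSpace.locallyPathConnectedSpace X E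

/-- The deck transformations of a universal covering are transitive on the fibres. -/
theorem exists_deck [SimplyConnectedSpace E] [LocallyPathConnectedSpace E] (hp : IsCoveringMap p)
    {x y : E} (h : p x = p y) : ∃ f : E ≃ₜ E, (∀ z, p (f z) = p z) ∧ f x = y := by
  have key : ∀ a b : E, p a = p b → ∃ F : C(E, E), F a = b ∧ p ∘ F = p := fun a b hab =>
    (hp.existsUnique_continuousMap_lifts ⟨p, hp.continuous⟩ a b hab.symm).exists
  obtain ⟨F, hF, hpF⟩ := key x y h
  obtain ⟨G, hG, hpG⟩ := key y x h.symm
  have hGF : ⇑G ∘ ⇑F = id := hp.eq_of_comp_eq (G.continuous.comp F.continuous) continuous_id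
    (by rw [← Function.comp_assoc, hpG, hpF, Function.comp_id]) x (by simp [hF, hG])
  have hFG : ⇑F ∘ ⇑G = id := hp.eq_of_comp_eq (F.continuous.comp G.continuous) continuous_id
    (by rw [← Function.comp_assoc, hpF, hpG, Function.comp_id]) y (by simp [hF, hG])
  exact ⟨⟨⟨F, G, congrFun hGF, congrFun hFG⟩, F.continuous, G.continuous⟩, congrFun hpF, hF⟩

theorem deck_eq [PreconnectedSpace E] (hp : IsCoveringMap p) {f g : E ≃ₜ E}
    (hf : ∀ z, p (f z) = p z) (hg : ∀ z, p (g z) = p z) (x : E) (h : f x = g x) : f = g :=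
  Homeomorph.ext (congrFun (hp.eq_of_comp_eq f.continuous g.continuous
    (funext fun z => (hf z).trans (hg z).symm) x h))

/-- A deck transformation takes lifts of a path to lifts. This turns composition of deck
transformations into concatenation of loops. -/
theorem monodromy_deck (hp : IsCoveringMap p) {f : E ≃ₜ E} (hf : ∀ z, p (f z) = p z) {a b : X}
    (γ : Path.Homotopic.Quotient a b) (e : p ⁻¹' {a}) :
    (hp.monodromy γ ⟨f e, (hf e).trans e.2⟩ : E) = f (hp.monodromy γ e : E) := by
  induction γ using Path.Homotopic.Quotient.ind with
  | mk γ =>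
    have h0 : γ 0 = p e := γ.source.trans e.2.symm
    have h0' : γ 0 = p (f e) := h0.trans (hf e).symm
    have : (⟨f, f.continuous⟩ : C(E, E)).comp (hp.liftPath γ e h0) = hp.liftPath γ (f e) h0' := by
      rw [hp.eq_liftPath_iff']
      refine ⟨?_, ?_⟩
      · have := hp.liftPath_lifts (γ : C(unitInterval, X)) e h0
        funext s
        exact (hf _).trans (congrFun this s)
      · exact congrArg f (hp.liftPath_zero (γ : C(unitInterval, X)) e h0)
    exact (congrArg (fun F : C(unitInterval, E) => F 1) this).symm

end Covering

/-! ## The topology of the ideal simplex -/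

theorem convex_idealSimplex :
    Convex ℝ {t : Fin 4 → ℝ | t ∈ stdSimplex ℝ (Fin 4) ∧ ∀ k, t k ≠ 1} := by
  intro s hs t ht a b ha hb hab
  refine ⟨convex_stdSimplex ℝ _ hs.1 ht.1 ha hb hab, fun k => ne_of_lt ?_⟩
  have le1 : ∀ {t : Fin 4 → ℝ}, t ∈ stdSimplex ℝ (Fin 4) → t k ≤ 1 := fun {t} ht => by
    rw [← ht.2]
    exact Finset.single_le_sum (fun j _ => ht.1 j) (Finset.mem_univ k)
  have hs1 := (le1 hs.1).lt_of_ne (hs.2 k)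
  have ht1 := (le1 ht.1).lt_of_ne (ht.2 k)
  simp only [Pi.add_apply, Pi.smul_apply, smul_eq_mul]
  rcases ha.eq_or_lt with rfl | ha
  · obtain rfl : b = 1 := by linarith
    linarith
  · nlinarith [mul_le_mul_of_nonneg_left ht1.le hb, mul_lt_mul_of_pos_left hs1 ha]

theorem convex_idealSimplex_face (f : Fin 4) :
    Convex ℝ {t : Fin 4 → ℝ | (t ∈ stdSimplex ℝ (Fin 4) ∧ ∀ k, t k ≠ 1) ∧ t f = 0} := by
  refine convex_idealSimplex.inter (t := {t : Fin 4 → ℝ | t f = 0}) ?_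
  intro s hs t ht a b _ _ _
  simp only [Set.mem_ofPred_eq, Pi.add_apply, Pi.smul_apply, smul_eq_mul] at *
  rw [hs, ht, mul_zero, mul_zero, add_zero]

theorem Convex.locallyPathConnectedSpace_subtype {V : Type*} [NormedAddCommGroup V]
    [NormedSpace ℝ V] {s : Set V} (hs : Convex ℝ s) : LocallyPathConnectedSpace s := by
  refine LocallyPathConnectedSpace.of_bases (p := fun _ r => 0 < r)
    (s := fun x r => Metric.ball x r) (fun x => Metric.nhds_basis_ball) fun x r hr => ?_
  rw [Topology.IsInducing.subtypeVal.isPathConnected_iff]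
  have : Subtype.val '' Metric.ball x r = s ∩ Metric.ball x.1 r := by
    ext y
    simp only [Set.mem_image, Metric.mem_ball, Subtype.exists, exists_and_right, exists_eq_right,
      Set.mem_inter_iff, Subtype.dist_eq, exists_prop]
  rw [this]
  exact (hs.inter (convex_ball x.1 r)).isPathConnected ⟨x, x.2, Metric.mem_ball_self hr⟩

/-- The point of the edge `k l` at distance `1 / (n + 2)` from the vertex `k`. -/
noncomputable def edgePoint (k l : Fin 4) (hkl : k ≠ l) (n : ℕ) : IdealSimplex :=
  ⟨fun j => if j = k then 1 - 1 / ((n : ℝ) + 2) else if j = l then 1 / ((n : ℝ) + 2) else 0, by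
    have h0 : 0 < 1 / ((n : ℝ) + 2) := by positivity
    have h1 : 1 / ((n : ℝ) + 2) < 1 := by
      rw [div_lt_one (by positivity)]
      linarith [n.cast_nonneg (α := ℝ)]
    refine ⟨⟨fun j => ?_, ?_⟩, fun j => ?_⟩
    · dsimp only
      split_ifs <;> linarith
    · rw [Finset.sum_ite, Finset.sum_ite]
      have e1 : (Finset.univ.filter fun j => j = k) = {k} := by ext; simp
      have e2 : ((Finset.univ.filter fun j => ¬ j = k).filter fun j => j = l) = {l} := by
        ext j
        simp only [Finset.mem_filter, Finset.mem_univ, true_and, Finset.mem_singleton]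
        exact ⟨fun h => h.2, fun h => ⟨h ▸ hkl.symm, h⟩⟩
      rw [e1, e2]
      simp
    · dsimp only
      split_ifs
      · linarith
      · exact h1.ne
      · exact zero_ne_one⟩

theorem edgePoint_face {k l f : Fin 4} (hkl : k ≠ l) (hk : k ≠ f) (hl : l ≠ f) (n : ℕ) :
    (edgePoint k l hkl n).1 f = 0 := by
  simp [edgePoint, hk.symm, hl.symm]

theorem permute_edgePoint (g : Equiv.Perm (Fin 4)) {k l : Fin 4} (hkl : k ≠ l) (n : ℕ) :
    (edgePoint k l hkl n).permute g = edgePoint (g k) (g l) (g.injective.ne hkl) n := by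
  refine Subtype.ext (funext fun j => ?_)
  obtain ⟨j, rfl⟩ := g.surjective j
  rw [IdealSimplex.permute_apply]
  simp [edgePoint]

/-- The vertex of the standard simplex. -/
def simplexVertex (k : Fin 4) : stdSimplex ℝ (Fin 4) := ⟨Pi.single k 1, single_mem_stdSimplex ℝ k⟩

theorem tendsto_edgePoint {k l : Fin 4} (hkl : k ≠ l) :
    Filter.Tendsto (fun n => (edgePoint k l hkl n).toSimplex) Filter.atTop
      (nhds (simplexVertex k)) := by
  rw [Topology.IsInducing.subtypeVal.tendsto_nhds_iff, tendsto_pi_nhds]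
  intro j
  have h : Filter.Tendsto (fun n : ℕ => 1 / ((n : ℝ) + 2)) Filter.atTop (nhds 0) := by
    have := (tendsto_one_div_add_atTop_nhds_zero_nat (𝕜 := ℝ)).comp (Filter.tendsto_add_atTop_nat 1)
    refine this.congr fun n => ?_
    simp only [Function.comp_apply]
    push_cast
    ring
  by_cases hj : j = k
  · subst hj
    simpa [edgePoint, IdealSimplex.toSimplex, simplexVertex] using h.const_sub 1
  · by_cases hj' : j = l
    · subst hj'
      simpa [edgePoint, IdealSimplex.toSimplex, simplexVertex, hj] using h
    · simp [edgePoint, IdealSimplex.toSimplex, simplexVertex, hj, hj']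

instance : LocallyPathConnectedSpace IdealSimplex :=
  Convex.locallyPathConnectedSpace_subtype convex_idealSimplex

instance : Nonempty IdealSimplex := ⟨edgePoint 0 1 (by decide) 0⟩

instance : ContractibleSpace IdealSimplex :=
  convex_idealSimplex.contractibleSpace ⟨_, (edgePoint 0 1 (by decide) 0).2⟩

theorem isInducing_idealSimplex_val :
    Topology.IsInducing fun t : IdealSimplex => t.1 := Topology.IsInducing.subtypeVal

theorem isPreconnected_idealSimplex_face (f : Fin 4) :
    IsPreconnected {t : IdealSimplex | t.1 f = 0} := by
  refine isInducing_idealSimplex_val.isPreconnected_image.1 ?_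
  have : (fun t : IdealSimplex => t.1) '' {t : IdealSimplex | t.1 f = 0}
      = {t : Fin 4 → ℝ | (t ∈ stdSimplex ℝ (Fin 4) ∧ ∀ k, t k ≠ 1) ∧ t f = 0} := by
    ext t
    constructor
    · rintro ⟨t, ht, rfl⟩
      exact ⟨t.2, ht⟩
    · rintro ⟨h, ht⟩
      exact ⟨⟨t, h⟩, ht, rfl⟩
  rw [this]
  exact (convex_idealSimplex_face f).isPreconnected

theorem continuous_permute (g : Equiv.Perm (Fin 4)) : Continuous (IdealSimplex.permute g) :=
  isInducing_idealSimplex_val.continuous_iff.2 (continuous_pi fun k =>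
    (continuous_apply (g.symm k)).comp continuous_subtype_val)

/-! ## The ideal vertices of straight maps -/

theorem IsStraight.smul {v : Fin 4 → Ideal3} {σ : IdealSimplex → H3} (h : IsStraight v σ)
    (g : PSL2C) : IsStraight (g • v) fun t => g • σ t := by
  obtain ⟨u, hu, f, hf, hσ⟩ := h
  choose hu0 hu using hu
  choose w hw hw1 hw2 using fun k => actMat_lightMat g (u k) (hu0 k)
  refine ⟨w, fun k => ⟨hw k, by rw [hw2, hu]; rfl⟩, f, hf, fun t => ?_⟩
  obtain ⟨r, hr, h⟩ := hσ t
  refine ⟨r, hr, ?_⟩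
  rw [smul_H3_val, h, actMat_smul, actMat_sum]
  congr 1
  refine Finset.sum_congr rfl fun k _ => ?_
  rw [actMat_smul]
  exact congrArg _ (hw1 k)

theorem trace_lightMat_ne_zero {u : Fin 2 → ℂ} (hu : u ≠ 0) : (lightMat u).trace ≠ 0 := by
  have h : (lightMat u).trace = ((‖u 0‖ ^ 2 + ‖u 1‖ ^ 2 : ℝ) : ℂ) := by
    rw [Matrix.trace_fin_two]
    simp only [lightMat, Matrix.vecMulVec_apply, Pi.star_apply, Complex.star_def, Complex.mul_conj,
      Complex.normSq_eq_norm_sq, Complex.ofReal_add]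
  rw [h]
  norm_cast
  intro h0
  apply hu
  have h1 : ‖u 0‖ = 0 := by nlinarith [sq_nonneg ‖u 0‖, sq_nonneg ‖u 1‖]
  have h2 : ‖u 1‖ = 0 := by nlinarith [sq_nonneg ‖u 0‖, sq_nonneg ‖u 1‖]
  ext i
  fin_cases i
  · exact norm_eq_zero.1 h1
  · exact norm_eq_zero.1 h2

theorem mk_eq_mk_of_lightMat {u w : Fin 2 → ℂ} (hu : u ≠ 0) (hw : w ≠ 0) {c : ℂ}
    (h : lightMat u = c • lightMat w) :
    Projectivization.mk ℂ u hu = Projectivization.mk ℂ w hw := by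
  obtain ⟨j, hj⟩ : ∃ j, u j ≠ 0 := by
    by_contra! h0
    exact hu (funext h0)
  refine mk_eq_mk_of_smul _ _ (c * star (w j) / star (u j)) (funext fun i => ?_)
  have := congrFun (congrFun h i) j
  simp only [lightMat, Matrix.smul_apply, Matrix.vecMulVec_apply, Pi.star_apply, smul_eq_mul] at this
  have hj' : star (u j) ≠ 0 := star_ne_zero.2 hj
  rw [Pi.smul_apply, smul_eq_mul, div_mul_eq_mul_div, div_eq_iff hj', this]
  ring

/-- The normalization of a matrix to trace one. -/
noncomputable def traceNormalize (A : Matrix (Fin 2) (Fin 2) ℂ) : Matrix (Fin 2) (Fin 2) ℂ :=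
  A.trace⁻¹ • A

theorem traceNormalize_smul {r : ℂ} (hr : r ≠ 0) (A : Matrix (Fin 2) (Fin 2) ℂ) :
    traceNormalize (r • A) = traceNormalize A := by
  rw [traceNormalize, traceNormalize, Matrix.trace_smul, smul_smul, smul_eq_mul, mul_inv,
    mul_right_comm, inv_mul_cancel₀ hr, one_mul]

/-- Trace normalization removes the unknown positive scale, so the limit towards the vertex `k`
exists in the space of matrices and spans the ray of `v k`. -/
theorem IsStraight.tendsto_edgePoint {v : Fin 4 → Ideal3} {σ : IdealSimplex → H3}
    (h : IsStraight v σ) {k l : Fin 4} (hkl : k ≠ l) :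
    ∃ (u : Fin 2 → ℂ) (hu : u ≠ 0), Projectivization.mk ℂ u hu = v k ∧
      Filter.Tendsto (fun n => traceNormalize (σ (edgePoint k l hkl n)).1) Filter.atTop
        (nhds (traceNormalize (lightMat u))) := by
  obtain ⟨u, hu, f, hf, hσ⟩ := h
  choose hu0 hu using hu
  refine ⟨u k, hu0 k, hu k, ?_⟩
  choose r hr hr' using hσ
  have h1 : ∀ n, traceNormalize (σ (edgePoint k l hkl n)).1 =
      traceNormalize (∑ j, ((f (edgePoint k l hkl n).toSimplex).1 j : ℂ) • lightMat (u j)) :=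
    fun n => by
      rw [hr', traceNormalize_smul (by exact_mod_cast (hr _).ne')]
      rfl
  simp only [h1]
  -- A face preserving homeomorphism fixes the vertices, so the parametrization does not affect the
  -- limit.
  have hfk : ∀ j, (f (simplexVertex k)).1 j = (simplexVertex k).1 j := by
    have h0 : ∀ j, j ≠ k → (f (simplexVertex k)).1 j = 0 := fun j hj =>
      (hf _ _).2 (by simp [simplexVertex, hj])
    intro j
    by_cases hj : j = k
    · subst hj
      have := (f (simplexVertex j)).2.2
      rw [Finset.sum_eq_single j (fun i _ hi => h0 i hi) (by simp)] at this
      rw [this]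
      simp [simplexVertex]
    · rw [h0 j hj]
      simp [simplexVertex, hj]
  have hlim : Filter.Tendsto (fun n =>
      ∑ j, ((f (edgePoint k l hkl n).toSimplex).1 j : ℂ) • lightMat (u j)) Filter.atTop
      (nhds (lightMat (u k))) := by
    have hcont : Continuous fun t : stdSimplex ℝ (Fin 4) =>
        ∑ j, ((f t).1 j : ℂ) • lightMat (u j) := by
      refine continuous_finsetSum _ fun j _ => ?_
      exact (Complex.continuous_ofReal.comp ((continuous_apply j).comp
        (continuous_subtype_val.comp f.continuous))).smul continuous_const
    have := (hcont.tendsto (simplexVertex k)).comp (IdealHyp.tendsto_edgePoint hkl)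
    have hval : ∑ j, ((f (simplexVertex k)).1 j : ℂ) • lightMat (u j) = lightMat (u k) := by
      simp only [hfk]
      rw [Finset.sum_eq_single k (fun j _ hj => by simp [simplexVertex, hj]) (by simp)]
      simp [simplexVertex]
    rw [hval] at this
    exact this
  have htr : Continuous fun A : Matrix (Fin 2) (Fin 2) ℂ => A.trace := continuous_id.matrix_trace
  exact (((htr.tendsto _).comp hlim).inv₀ (trace_lightMat_ne_zero (hu0 k))).smul hlim

/-- The ideal vertices of a straight map are determined by its restriction to an edge. -/
theorem IsStraight.vertex_eq {v v' : Fin 4 → Ideal3} {σ σ' : IdealSimplex → H3}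
    (h : IsStraight v σ) (h' : IsStraight v' σ') {k l k' l' : Fin 4} (hkl : k ≠ l) (hkl' : k' ≠ l')
    (heq : ∀ n, σ (edgePoint k l hkl n) = σ' (edgePoint k' l' hkl' n)) : v k = v' k' := by
  obtain ⟨u, hu, hv, hlim⟩ := h.tendsto_edgePoint hkl
  obtain ⟨u', hu', hv', hlim'⟩ := h'.tendsto_edgePoint hkl'
  simp only [heq] at hlim
  have := tendsto_nhds_unique hlim hlim'
  rw [← hv, ← hv']
  refine mk_eq_mk_of_lightMat hu hu' (c := (lightMat u).trace * (lightMat u').trace⁻¹) ?_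
  rw [mul_smul]
  change _ = _ • traceNormalize (lightMat u')
  rw [← this, traceNormalize, smul_smul, mul_inv_cancel₀ (trace_lightMat_ne_zero hu), one_smul]

theorem IsStraight.vertices_eq {v v' : Fin 4 → Ideal3} {σ : IdealSimplex → H3}
    (h : IsStraight v σ) (h' : IsStraight v' σ) : v = v' := by
  funext k
  obtain ⟨l, hl⟩ := exists_ne k
  exact h.vertex_eq h' hl.symm hl.symm fun _ => rfl

namespace IdealTriangulation

variable {ι : Type*} (T : IdealTriangulation ι)

instance : LocallyPathConnectedSpace T.Space :=
  inferInstanceAs (LocallyPathConnectedSpace (Quot T.FacePairing))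

/-! ## Lifts of the tetrahedra to covering spaces -/

section Lifts

variable {T} {E : Type*} [TopologicalSpace E] {p : E → T.Space}

theorem exists_isLift (hp : IsCoveringMap p) {i : ι} {t : IdealSimplex} {x : E}
    (h : p x = T.char i t) : ∃ τ, T.IsLift p i τ ∧ τ t = x := by
  obtain ⟨F, ⟨h1, h2⟩, -⟩ :=
    hp.existsUnique_continuousMap_lifts ⟨T.char i, T.continuous_char i⟩ t x h
  exact ⟨F, ⟨F.continuous, congrFun h2⟩, h1⟩

theorem exists_isLift_through (hp : IsCoveringMap p) (x : E) :
    ∃ i τ t, T.IsLift p i τ ∧ τ t = x := by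
  obtain ⟨i, t, h⟩ := T.exists_eq_char (p x)
  obtain ⟨τ, hτ, hx⟩ := exists_isLift hp h
  exact ⟨i, τ, t, hτ, hx⟩

/-- Adjacent lifts agree on their common face. -/
theorem IsLift.agree_on_face (hp : IsCoveringMap p) {i : ι} {f : Fin 4} {τ τ' : IdealSimplex → E}
    (hτ : T.IsLift p i τ) (hτ' : T.IsLift p (T.adj i f) τ') {t : IdealSimplex} (ht : t.1 f = 0)
    (h : τ' (t.permute (T.glue i f)) = τ t) (s : IdealSimplex) (hs : s.1 f = 0) :
    τ' (s.permute (T.glue i f)) = τ s := by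
  have hc : Continuous fun s : IdealSimplex => τ' (s.permute (T.glue i f)) :=
    hτ'.1.comp (continuous_permute _)
  refine hp.eqOn_of_comp_eqOn (isPreconnected_idealSimplex_face f) hc.continuousOn
    hτ.1.continuousOn (fun s hs => ?_) (a := t) ht h hs
  simp only [Function.comp_apply]
  rw [hτ'.2, hτ.2, T.char_adj i f s hs]

/-- The topology of a covering space is coherent with its ideal tetrahedra. -/
theorem isOpen_of_lifts (hp : IsCoveringMap p) {A : Set E}
    (hA : ∀ i τ, T.IsLift p i τ → IsOpen (τ ⁻¹' A)) : IsOpen A := by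
  refine isOpen_iff_mem_nhds.2 fun x hx => ?_
  obtain ⟨e, hxe, he⟩ := hp.isLocalHomeomorph x
  -- Openness is tested in `T.Space`, whose topology is coherent by definition: each point over a
  -- tetrahedron lies on a lift, where the hypothesis applies. The local homeomorphism carries the
  -- result back to `E`.
  have hopen : IsOpen (p '' (A ∩ e.source)) := by
    refine T.isOpen_space_iff.2 fun i => isOpen_iff_mem_nhds.2 ?_
    rintro t ⟨y, hy, hyt⟩
    obtain ⟨τ, hτ, rfl⟩ := exists_isLift hp hyt
    refine Filter.mem_of_superset ((((hA i τ hτ).inter (e.open_source.preimage hτ.1)).mem_nhds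
      ⟨hy.1, hy.2⟩)) ?_
    rintro s ⟨h1, h2⟩
    exact ⟨τ s, ⟨h1, h2⟩, hτ.2 s⟩
  refine Filter.mem_of_superset ((e.open_source.inter (hopen.preimage hp.continuous)).mem_nhds
    ⟨hxe, x, ⟨hx, hxe⟩, rfl⟩) ?_
  rintro y ⟨hy, w, hw, hwy⟩
  have : w = y := e.injOn hw.2 hy (by rw [← he]; exact hwy)
  exact this ▸ hw.1

end Lifts

/-! ## Existence of pseudo-developing maps -/

section Existence

variable {T} {Z : ι → Fin 3 → ℂ} [Fintype ι] (hz : ∀ i, IsShape (Z i))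
  (hZ : Z ∈ T.deformationVariety) {E : Type*} [TopologicalSpace E] {p : E → T.Space}

/-- A lift of the covering projection to the developed space develops the tetrahedra. -/
theorem exists_comp_lift_eq_char {F : E → (T.developed hz).Space} (hZ : Z ∈ T.deformationVariety)
    (hF : Continuous F) (hpF : ∀ x, T.developedProj hz (F x) = p x) {i : ι} {τ : IdealSimplex → E}
    (hτ : T.IsLift p i τ) : ∃ x : Developed Z, x.1.1 = i ∧ F ∘ τ = (T.developed hz).char x := by
  have hq := T.isQuotientCoveringMap_developedProj hz hZ
  obtain ⟨t⟩ : Nonempty IdealSimplex := inferInstance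
  have h0 : T.developedProj hz (F (τ t))
      = T.developedProj hz ((T.developed hz).char (stdDeveloped hz i) t) := by
    rw [hpF, hτ.2]
    rfl
  obtain ⟨g, hg⟩ := hq.apply_eq_iff_mem_orbit.1 h0
  refine ⟨g • stdDeveloped hz i, rfl, ?_⟩
  refine hq.isCoveringMap.eq_of_comp_eq (hF.comp hτ.1) ((T.developed hz).continuous_char _)
    (funext fun s => ?_) t hg.symm
  simp only [Function.comp_apply]
  rw [hpF, hτ.2]
  rfl

theorem isPseudoDeveloping_devMap {F : E → (T.developed hz).Space} (hF : Continuous F)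
    (hpF : ∀ x, T.developedProj hz (F x) = p x) :
    T.IsPseudoDeveloping p Z (T.devMap hz hZ ∘ F) where
  continuous := (T.continuous_devMap hz hZ).comp hF
  straight i τ hτ := by
    obtain ⟨x, rfl, hx⟩ := exists_comp_lift_eq_char hz hZ hF hpF hτ
    refine ⟨x.1.2, x.2, ?_⟩
    rw [Function.comp_assoc, hx]
    exact T.isStraight_devTet hz x

/-- For a deck transformation `h`, the maps `F ∘ h` and `g • F` lift the same projection, so they
agree once they agree at `x₀`; transitivity on fibres provides `g`. Freeness makes `g` unique, hence
multiplicative in `γ`. -/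
theorem exists_isEquivariant_devMap [SimplyConnectedSpace E] [LocallyPathConnectedSpace E] (hp : IsCoveringMap p) (x₀ : E)
    {F : E → (T.developed hz).Space} (hF : Continuous F)
    (hpF : ∀ x, T.developedProj hz (F x) = p x) :
    ∃ ρ, IsEquivariant hp x₀ (T.devMap hz hZ ∘ F) ρ := by
  have hq := T.isQuotientCoveringMap_developedProj hz hZ
  have hfree := hq.isCancelSMul
  have hdeck : ∀ γ : FundamentalGroup T.Space (p x₀), ∃ f : E ≃ₜ E, (∀ z, p (f z) = p z) ∧
      f x₀ = (hp.monodromy (FundamentalGroup.toPath γ⁻¹) ⟨x₀, rfl⟩ : p ⁻¹' {p x₀}) := fun γ =>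
    exists_deck hp (hp.monodromy (FundamentalGroup.toPath γ⁻¹) ⟨x₀, rfl⟩ : p ⁻¹' {p x₀}).2.symm
  choose h hph hx using hdeck
  have hg : ∀ γ, ∃ g : PSL2C, ∀ x, F (h γ x) = g • F x := by
    intro γ
    obtain ⟨g, hg⟩ := hq.apply_eq_iff_mem_orbit.1
      (((hpF (h γ x₀)).trans (hph γ x₀)).trans (hpF x₀).symm)
    refine ⟨g, congrFun (hq.isCoveringMap.eq_of_comp_eq (hF.comp (h γ).continuous)
      ((hq.continuous_const_smul g).comp hF) (funext fun x => ?_) x₀ hg.symm)⟩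
    simp only [Function.comp_apply]
    rw [hpF, hph, hq.map_smul, hpF]
  choose r hr using hg
  have hmul : ∀ γ δ, h (γ * δ) = (h δ).trans (h γ) := by
    intro γ δ
    refine deck_eq hp (hph _) (fun z => (hph γ _).trans (hph δ z)) x₀ ?_
    -- The lift of `(γ * δ)⁻¹ = δ⁻¹ * γ⁻¹` first follows `γ⁻¹` and then `δ⁻¹`; its second half is
    -- the image under `h γ` of the lift of `δ⁻¹` from `x₀`.
    rw [hx, Homeomorph.trans_apply, hx δ, ← monodromy_deck hp (hph γ), mul_inv_rev]
    refine congrArg Subtype.val ((hp.monodromy_trans_apply (FundamentalGroup.toPath γ⁻¹)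
      (FundamentalGroup.toPath δ⁻¹) ⟨x₀, rfl⟩).trans (congrArg _ (Subtype.ext (hx γ).symm)))
  refine ⟨MonoidHom.mk' r fun γ δ => ?_, fun γ => ⟨h γ, hph γ, hx γ, fun x => ?_⟩⟩
  · refine hfree.right_cancel' _ _ (F x₀) ?_
    rw [← hr, hmul, Homeomorph.trans_apply, hr, hr, mul_smul]
  · simp only [Function.comp_apply, MonoidHom.mk'_apply]
    rw [hr, T.devMap_smul hz hZ]

end Existence

/-! ## Uniqueness of pseudo-developing maps -/

section Uniqueness

variable {T}

theorem exists_ne_pair (k f : Fin 4) : ∃ l, l ≠ k ∧ l ≠ f := by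
  revert k f
  decide

/-- Each vertex of the common face is an end of an edge in that face, and the two maps agree along
this edge. -/
theorem IsStraight.vertices_adj {E : Type*} {Φ : E → H3} {i : ι} {f : Fin 4}
    {τ τ' : IdealSimplex → E}
    (h : ∀ s : IdealSimplex, s.1 f = 0 → τ' (s.permute (T.glue i f)) = τ s)
    {v w : Fin 4 → Ideal3} (hv : IsStraight v (Φ ∘ τ)) (hw : IsStraight w (Φ ∘ τ')) (k : Fin 4)
    (hk : k ≠ f) : w (T.glue i f k) = v k := by
  obtain ⟨l, hlk, hlf⟩ := exists_ne_pair k f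
  refine hw.vertex_eq hv ((T.glue i f).injective.ne hlk.symm) hlk.symm fun n => ?_
  simp only [Function.comp_apply]
  rw [← permute_edgePoint, h _ (edgePoint_face _ hk hlf n)]

variable {Z : ι → Fin 3 → ℂ} {E : Type*} [TopologicalSpace E] {p : E → T.Space}
  {Φ Φ' : E → H3}

/-- The isometry `g` takes the ideal vertices of the image of a tetrahedron under `Φ` to those of
its image under `Φ'`. -/
def MovesVertices (Φ Φ' : E → H3) (g : PSL2C) (τ : IdealSimplex → E) : Prop :=
  ∀ v : Fin 4 → Ideal3, IsStraight v (Φ ∘ τ) → IsStraight (fun k => g • v k) (Φ' ∘ τ)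

theorem exists_movesVertices (hΦ : T.IsPseudoDeveloping p Z Φ) (hΦ' : T.IsPseudoDeveloping p Z Φ')
    {i : ι} {τ : IdealSimplex → E} (hτ : T.IsLift p i τ) : ∃ g, MovesVertices Φ Φ' g τ := by
  obtain ⟨v, hv, hs⟩ := hΦ.straight i τ hτ
  obtain ⟨v', hv', hs'⟩ := hΦ'.straight i τ hτ
  obtain ⟨g, rfl⟩ := hv.exists_smul_eq hv'
  refine ⟨g, fun w hw => ?_⟩
  rw [hw.vertices_eq hs]
  exact hs'

theorem MovesVertices.unique (hz : ∀ i, IsShape (Z i)) (hΦ : T.IsPseudoDeveloping p Z Φ)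
    {i : ι} {τ : IdealSimplex → E} (hτ : T.IsLift p i τ) {g g' : PSL2C}
    (h : MovesVertices Φ Φ' g τ) (h' : MovesVertices Φ Φ' g' τ) : g = g' := by
  obtain ⟨v, hv, hs⟩ := hΦ.straight i τ hτ
  exact psl_eq_of_smul_vertices_eq (hv.injective (hz i)) ((h v hs).vertices_eq (h' v hs))

/-- Some `g'` works for the neighbour. It agrees with `g` on the three ideal vertices of the common
face, which are distinct, so `g' = g`. -/
theorem MovesVertices.adj (hz : ∀ i, IsShape (Z i)) (hΦ : T.IsPseudoDeveloping p Z Φ)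
    (hΦ' : T.IsPseudoDeveloping p Z Φ') {i : ι} {f : Fin 4} {τ τ' : IdealSimplex → E}
    (hτ : T.IsLift p i τ) (hτ' : T.IsLift p (T.adj i f) τ')
    (h : ∀ s : IdealSimplex, s.1 f = 0 → τ' (s.permute (T.glue i f)) = τ s) {g : PSL2C}
    (hg : MovesVertices Φ Φ' g τ) : MovesVertices Φ Φ' g τ' := by
  obtain ⟨g', hg'⟩ := exists_movesVertices hΦ hΦ' hτ'
  obtain ⟨v, hv, hs⟩ := hΦ.straight i τ hτ
  obtain ⟨w, hw, hs'⟩ := hΦ.straight _ τ' hτ'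
  have : g = g' := by
    refine psl_eq_of_smul_face_eq (hw.injective (hz _)) (T.glue i f f) fun k hk => ?_
    obtain ⟨k, rfl⟩ := (T.glue i f).surjective k
    have hk' : k ≠ f := fun h => hk (by rw [h])
    have h1 := IsStraight.vertices_adj h hs hs' k hk'
    have h2 := IsStraight.vertices_adj h (hg v hs) (hg' w hs') k hk'
    exact (congrArg (g • ·) h1).trans h2.symm
  rw [this]
  exact hg'

/-- Two lifts through the same point are joined by a chain of face pairings, which lifts to a chain
of adjacent tetrahedra all passing through that point. -/
theorem MovesVertices.of_point (hp : IsCoveringMap p) (hz : ∀ i, IsShape (Z i))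
    (hΦ : T.IsPseudoDeveloping p Z Φ) (hΦ' : T.IsPseudoDeveloping p Z Φ') {i i' : ι}
    {τ τ' : IdealSimplex → E} (hτ : T.IsLift p i τ) (hτ' : T.IsLift p i' τ') {t t' : IdealSimplex}
    (h : τ t = τ' t') {g : PSL2C} (hg : MovesVertices Φ Φ' g τ) : MovesVertices Φ Φ' g τ' := by
  have hE : Relation.EqvGen T.FacePairing ⟨i, t⟩ ⟨i', t'⟩ :=
    Quot.eqvGen_exact ((hτ.2 t).symm.trans ((congrArg p h).trans (hτ'.2 t')))
  rw [Relation.EqvGen.eqvGen_eq_reflTransGen] at hE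
  have key : ∀ b : Σ _ : ι, IdealSimplex, Relation.ReflTransGen T.FacePairing ⟨i, t⟩ b →
      ∀ τ', T.IsLift p b.1 τ' → τ' b.2 = τ t → MovesVertices Φ Φ' g τ' := by
    intro b hb
    induction hb with
    | refl =>
      intro τ' hτ' h
      have : τ' = τ := hp.eq_of_comp_eq hτ'.1 hτ.1
        (funext fun s => (hτ'.2 s).trans (hτ.2 s).symm) t h
      rw [this]
      exact hg
    | tail _ hstep ih =>
      intro τ' hτ' h
      obtain ⟨j, f, s, hs⟩ := hstep
      obtain ⟨τ₁, hτ₁, h₁⟩ := exists_isLift hp (i := j) (t := s) (x := τ t)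
        (by rw [← h, hτ'.2]; exact T.char_adj j f s hs)
      exact (ih τ₁ hτ₁ h₁).adj hz hΦ hΦ' hτ₁ hτ'
        (hτ₁.agree_on_face hp hτ' hs (h.trans h₁.symm))
  exact key _ hE τ' hτ' h.symm

/-- The points on lifts moved correctly by `g` form a set that contains each lift or misses it. By
coherence of the topology it is clopen. -/
theorem exists_movesVertices_all [ConnectedSpace E] (hp : IsCoveringMap p)
    (hz : ∀ i, IsShape (Z i)) (hΦ : T.IsPseudoDeveloping p Z Φ)
    (hΦ' : T.IsPseudoDeveloping p Z Φ') :
    ∃ g, ∀ i τ, T.IsLift p i τ → MovesVertices Φ Φ' g τ := by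
  obtain ⟨x₀⟩ : Nonempty E := inferInstance
  obtain ⟨i₀, τ₀, t₀, hτ₀, -⟩ := exists_isLift_through hp x₀
  obtain ⟨g, hg⟩ := exists_movesVertices hΦ hΦ' hτ₀
  let A : Set E := {x | ∃ i τ t, T.IsLift p i τ ∧ τ t = x ∧ MovesVertices Φ Φ' g τ}
  have hA : ∀ i τ, T.IsLift p i τ → ∀ t, τ t ∈ A ↔ MovesVertices Φ Φ' g τ := by
    intro i τ hτ t
    constructor
    · rintro ⟨j, τ', t', hτ', h, hg'⟩
      exact hg'.of_point hp hz hΦ hΦ' hτ' hτ h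
    · intro h
      exact ⟨i, τ, t, hτ, rfl, h⟩
  have hclopen : IsClopen A := by
    refine ⟨⟨isOpen_of_lifts hp fun i τ hτ => ?_⟩, isOpen_of_lifts hp fun i τ hτ => ?_⟩
    · by_cases h : MovesVertices Φ Φ' g τ
      · have : τ ⁻¹' Aᶜ = ∅ := by ext t; simp [hA i τ hτ t, h]
        rw [this]
        exact isOpen_empty
      · have : τ ⁻¹' Aᶜ = Set.univ := by ext t; simp [hA i τ hτ t, h]
        rw [this]
        exact isOpen_univ
    · by_cases h : MovesVertices Φ Φ' g τ
      · have : τ ⁻¹' A = Set.univ := by ext t; simp [hA i τ hτ t, h]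
        rw [this]
        exact isOpen_univ
      · have : τ ⁻¹' A = ∅ := by ext t; simp [hA i τ hτ t, h]
        rw [this]
        exact isOpen_empty
  have huniv : A = Set.univ := hclopen.eq_univ ⟨τ₀ t₀, (hA i₀ τ₀ hτ₀ t₀).2 hg⟩
  refine ⟨g, fun i τ hτ => (hA i τ hτ t₀).1 ?_⟩
  rw [huniv]
  trivial

end Uniqueness

end IdealTriangulation

end IdealHyp

/-! ### The theorem: existence, prescription of one tetrahedron, uniqueness. -/

open IdealHyp in
theorem corollary1p2 {ι : Type*} [Fintype ι] (T : IdealTriangulation ι) [ConnectedSpace T.Space]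
    (Z : ι → Fin 3 → ℂ) (hZ : Z ∈ T.deformationVariety)
    {E : Type*} [TopologicalSpace E] [SimplyConnectedSpace E] (p : E → T.Space)
    (hp : IsCoveringMap p) (x₀ : E) :
    -- existence of a pseudo-developing map and of its representation
    (∃ (Φ : E → H3) (ρ : FundamentalGroup T.Space (p x₀) →* PSL2C),
      T.IsPseudoDeveloping p Z Φ ∧ IsEquivariant hp x₀ Φ ρ) ∧
    -- the image of one ideal tetrahedron of the specified shape may be prescribed
    (∀ (i : ι) (τ : IdealSimplex → E), T.IsLift p i τ →
      ∀ v : Fin 4 → Ideal3, HasShape v (Z i) →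
        ∃ (Φ : E → H3) (ρ : FundamentalGroup T.Space (p x₀) →* PSL2C),
          T.IsPseudoDeveloping p Z Φ ∧ IsEquivariant hp x₀ Φ ρ ∧ IsStraight v (Φ ∘ τ)) ∧
    -- uniqueness: any two such pairs differ by a unique isometry
    (∀ (Φ Φ' : E → H3) (ρ ρ' : FundamentalGroup T.Space (p x₀) →* PSL2C),
      T.IsPseudoDeveloping p Z Φ → IsEquivariant hp x₀ Φ ρ →
      T.IsPseudoDeveloping p Z Φ' → IsEquivariant hp x₀ Φ' ρ' →
        ∃! g : PSL2C,
          (∀ (i : ι) (τ : IdealSimplex → E), T.IsLift p i τ → ∀ v : Fin 4 → Ideal3,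
            IsStraight v (Φ ∘ τ) → IsStraight (fun k => g • v k) (Φ' ∘ τ)) ∧
          ∀ γ, ρ' γ = g * ρ γ * g⁻¹) := by
  have hz : ∀ i, IsShape (Z i) := fun i =>
    ⟨hZ.1 i, (hZ.2.1 i).1, (hZ.2.1 i).2.1, (hZ.2.1 i).2.2⟩
  have : LocallyPathConnectedSpace E :=
    locallyPathConnectedSpace_of_isLocalHomeomorph hp.isLocalHomeomorph
  have hq := T.isQuotientCoveringMap_developedProj hz hZ
  have part2 : ∀ (i : ι) (τ : IdealSimplex → E), T.IsLift p i τ →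
      ∀ v : Fin 4 → Ideal3, HasShape v (Z i) →
        ∃ (Φ : E → H3) (ρ : FundamentalGroup T.Space (p x₀) →* PSL2C),
          T.IsPseudoDeveloping p Z Φ ∧ IsEquivariant hp x₀ Φ ρ ∧ IsStraight v (Φ ∘ τ) := by
    intro i τ hτ v hv
    obtain ⟨t⟩ : Nonempty IdealSimplex := inferInstance
    -- The lift is based at a point of the developed tetrahedron `(i, v)`, which forces `F ∘ τ` to
    -- be its characteristic map.
    obtain ⟨F, ⟨hF, hpF⟩, -⟩ := hq.isCoveringMap.existsUnique_continuousMap_lifts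
      ⟨p, hp.continuous⟩ (τ t) ((T.developed hz).char ⟨(i, v), hv⟩ t) (hτ.2 t).symm
    have hpF' : ∀ x, T.developedProj hz (F x) = p x := congrFun hpF
    obtain ⟨ρ, hρ⟩ :=
      IdealTriangulation.exists_isEquivariant_devMap hz hZ hp x₀ F.continuous hpF'
    refine ⟨_, ρ, IdealTriangulation.isPseudoDeveloping_devMap hz hZ F.continuous hpF', hρ, ?_⟩
    have : F ∘ τ = (T.developed hz).char ⟨(i, v), hv⟩ :=
      hq.isCoveringMap.eq_of_comp_eq (F.continuous.comp hτ.1) ((T.developed hz).continuous_char _)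
        (funext fun s => (hpF' _).trans (hτ.2 s)) t hF
    rw [Function.comp_assoc, this]
    exact T.isStraight_devTet hz ⟨(i, v), hv⟩
  refine ⟨?_, part2, ?_⟩
  · obtain ⟨i, τ, t, hτ, -⟩ := IdealTriangulation.exists_isLift_through hp x₀
    obtain ⟨Φ, ρ, h1, h2, -⟩ := part2 i τ hτ _ (hasShape_stdVertices (hz i))
    exact ⟨Φ, ρ, h1, h2⟩
  · intro Φ Φ' ρ ρ' hΦ hρ hΦ' hρ'
    obtain ⟨g, hg⟩ := IdealTriangulation.exists_movesVertices_all hp hz hΦ hΦ'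
    obtain ⟨i, τ, t, hτ, -⟩ := IdealTriangulation.exists_isLift_through hp x₀
    refine ⟨g, ⟨hg, fun γ => ?_⟩, fun g' hg' => ?_⟩
    · obtain ⟨h, hph, hx, hΦh⟩ := hρ γ
      obtain ⟨h', hph', hx', hΦh'⟩ := hρ' γ
      obtain rfl : h = h' := deck_eq hp hph hph' x₀ (hx.trans hx'.symm)
      have hlift : T.IsLift p i (h ∘ τ) :=
        ⟨h.continuous.comp hτ.1, fun s => (hph _).trans (hτ.2 s)⟩
      obtain ⟨v, hv, hs⟩ := hΦ.straight i τ hτ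
      have h1 : IsStraight (ρ γ • v) (Φ ∘ (h ∘ τ)) := by
        have : Φ ∘ (h ∘ τ) = fun s => ρ γ • (Φ ∘ τ) s := funext fun s => hΦh (τ s)
        rw [this]
        exact hs.smul (ρ γ)
      have h2 : IsStraight (ρ' γ • fun k => g • v k) (Φ' ∘ (h ∘ τ)) := by
        have : Φ' ∘ (h ∘ τ) = fun s => ρ' γ • (Φ' ∘ τ) s := funext fun s => hΦh' (τ s)
        rw [this]
        exact (hg i τ hτ v hs).smul (ρ' γ)
      -- The ideal vertices of `Φ'` on the translate `h ∘ τ` are computed in two ways, as `g * ρ γ`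
      -- and as `ρ' γ * g` applied to `v`.
      have h3 := (hg i (h ∘ τ) hlift _ h1).vertices_eq h2
      rw [eq_mul_inv_iff_mul_eq]
      refine psl_eq_of_smul_vertices_eq (hv.injective (hz i)) (funext fun k => ?_)
      have := congrFun h3 k
      simp only [Pi.smul_apply, ← mul_smul] at this ⊢
      exact this.symm
    · exact IdealTriangulation.MovesVertices.unique hz hΦ hτ (hg'.1 i τ hτ) (hg i τ hτ)
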